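/- Let $d\ge 0$ be an integer. For $h:\mathbb{R}^d\to\mathbb{C}$ let $\widehat h(\xi)=\int_{\mathbb{R}^d}h(x)e^{-2\pi i x\cdot\xi}\,dx$ denote the Fourier transform (extended to $L^2(\mathbb{R}^d)$ as a unitary operator). For a positive definite kernel $k$ on a set $E$ let $H_k\subset\mathbb{C}^E$ denote its reproducing kernel Hilbert space, i.e. the Hilbert space of functions that contains $k_x=k(\cdot,x)$ for all $x\in E$ and satisfies $\langle k_x,h\rangle_{H_k}=h(x)$ for all $h\in H_k$, $x\in E$. Let $u:\mathbb{R}^d\to\mathbb{C}$ be continuous, square integrable and not identically zero, with $\widehat u\in L^1\cap L^\infty$ and $\widehat u\ge 0$ almost everywhere, and let $k(x,y)=u(x-y)$. Put $\|h\|_{L^2(\widehat u)}=\left(\int_{\mathbb{R}^d}|h(\xi)|^2\,\widehat u(\xi)\,d\xi\right)^{1/2}$. For $z\in\mathbb{C}^d$ let $(m_zh)(\xi)=e^{-2\pi i z^\top\xi}h(\xi)$, let $P_n\subset\mathbb{C}[\xi_1,\dots,\xi_d]$ be the space of polynomials of total degree at most $n$, and let $$\mathcal{G}(u)=\{A\in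 \mathrm{GL}_d(\mathbb{R}) : \text{there is } \lambda>0 \text{ with } \widehat u(A^\top\xi)\ge\lambda\,\widehat u(\xi)\text{ for a.e. }\xi\}.$$ Assume that (A) for every $a>0$ there is $c_a>0$ such that $|\widehat u(\xi)|\le c_a e^{-a|\xi|}$ for a.e. $\xi$; (B) $\displaystyle\sup_{z\in\mathbb{C}^d}\ \limsup_{n\to\infty}\left(\sup_{P\in P_n\setminus\{0\}}\frac{\|m_zP\|_{L^2(\widehat u)}}{\|P\|_{L^2(\widehat u)}}\right)^{1/n}<\infty$; (C) $\mathcal{G}(u)$ spans the real vector space $\mathrm{M}_d(\mathbb{R})$. Then $k$ is a (real-)analytic positive definite kernel on $\mathbb{R}^d$, and for every open set $U\subset\mathbb{R}^d$ and every map $f:U\to\mathbb{R}^d$ the following are equivalent: (i) there are $A\in\mathcal{G}(u)$ and $b\in\mathbb{R}^d$ such that $f(x)=Ax+b$ for all $x\in U$; (ii) the composition operator $C_f:H_k\to H_{k|_{U^2}}$, $C_fh=h\circ f$, with domain $\mathcal{D}(C_f)=\{h\in H_k : h\circ f\in H_{k|_{U^2}}\}$, satisfies $\mathcal{D}(C_f)=H_k$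 and is a bounded linear operator. -/

import Mathlib

open MeasureTheory Filter Topology
open scoped ENNReal FourierTransform ComplexOrder

/-! ### Reproducing kernel Hilbert spaces of scalar kernels -/

/-- A scalar kernel `k` on `X`, as a kernel with values in the operators on `ℂ`
(multiplication by `k x y`). -/
noncomputable def operatorKernel {X : Type*} (k : Matrix X X ℂ) : Matrix X X (ℂ →L[ℂ] ℂ) :=
  Matrix.of fun x y => k x y • ContinuousLinearMap.id ℂ ℂ

theorem operatorKernel_posSemidef {X : Type*} {k : Matrix X X ℂ} (hk : k.PosSemidef) :
    (operatorKernel k).PosSemidef := by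
  have herm : (operatorKernel k).IsHermitian := by
    ext x y
    have h1 : star (k y x) = k x y := hk.1.apply x y
    have h2 : star (ContinuousLinearMap.id ℂ ℂ) = ContinuousLinearMap.id ℂ ℂ :=
      star_one (ℂ →L[ℂ] ℂ)
    simp [operatorKernel, Matrix.conjTranspose_apply, ← h1, h2]
  have key := (RKHS.posSemidef_tfae (K := operatorKernel k)).out 0 2
  refine key.2 ⟨herm, fun v => ?_⟩
  have h := hk.2 v
  have h2 := (Complex.le_def.1 h).1
  rw [Finsupp.sum_comm] at h2
  refine h2.trans (le_of_eq ?_)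
  have h3 : ∀ z : ℂ, z.re = RCLike.re (starRingEnd ℂ z) := fun z => by simp
  rw [h3]
  congr 1
  simp only [map_finsuppSum]
  refine Finsupp.sum_congr fun i _ => Finsupp.sum_congr fun j _ => ?_
  simp [operatorKernel]
  ring

/-- The reproducing kernel Hilbert space `H_k` of a positive (semi)definite kernel `k` on `X`.
Its elements are, through the coercion to functions, complex-valued functions on `X`. -/
def KernelSpace {X : Type*} (k : Matrix X X ℂ) (hk : k.PosSemidef) : Type _ :=
  @RKHS.OfKernel ℂ _ X ℂ _ _ _ (operatorKernel k) ⟨operatorKernel_posSemidef hk⟩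

namespace KernelSpace

variable {X : Type*} (k : Matrix X X ℂ) (hk : k.PosSemidef)

noncomputable instance : NormedAddCommGroup (KernelSpace k hk) :=
  haveI : Fact (operatorKernel k).PosSemidef := ⟨operatorKernel_posSemidef hk⟩
  inferInstanceAs (NormedAddCommGroup (RKHS.OfKernel (operatorKernel k)))

noncomputable instance : InnerProductSpace ℂ (KernelSpace k hk) :=
  haveI : Fact (operatorKernel k).PosSemidef := ⟨operatorKernel_posSemidef hk⟩
  inferInstanceAs (InnerProductSpace ℂ (RKHS.OfKernel (operatorKernel k)))

instance : CompleteSpace (KernelSpace k hk) :=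
  haveI : Fact (operatorKernel k).PosSemidef := ⟨operatorKernel_posSemidef hk⟩
  inferInstanceAs (CompleteSpace (RKHS.OfKernel (operatorKernel k)))

noncomputable instance : RKHS ℂ (KernelSpace k hk) X ℂ :=
  haveI : Fact (operatorKernel k).PosSemidef := ⟨operatorKernel_posSemidef hk⟩
  inferInstanceAs (RKHS ℂ (RKHS.OfKernel (operatorKernel k)) X ℂ)

/-- The function `k_y = k(·, y)` belongs to `H_k`, and has the reproducing property. -/
theorem exists_reproducing (y : X) : ∃ ky : KernelSpace k hk,
    (∀ x, ky x = k x y) ∧ ∀ h : KernelSpace k hk, inner ℂ ky h = h y := by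
  have : Fact (operatorKernel k).PosSemidef := ⟨operatorKernel_posSemidef hk⟩
  have hK : RKHS.kernel (KernelSpace k hk) = operatorKernel k :=
    RKHS.OfKernel.kernel_ofKernel (K := operatorKernel k)
  refine ⟨RKHS.kerFun (KernelSpace k hk) y 1, fun x => ?_, fun h => ?_⟩
  · rw [RKHS.kerFun_apply, hK]
    simp [operatorKernel]
  · rw [RKHS.kerFun_inner]
    simp

end KernelSpace

/-! ### Composition operators -/

/-- The composition operator `h ↦ h ∘ f` from a space `W` of functions on `F` to a space `V` of
functions on `E`, with domain `{h ∈ W | h ∘ f ∈ V}`. -/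
noncomputable def compositionOperator {E F : Type*} (W V : Type*)
    [NormedAddCommGroup W] [InnerProductSpace ℂ W] [RKHS ℂ W F ℂ]
    [NormedAddCommGroup V] [InnerProductSpace ℂ V] [RKHS ℂ V E ℂ]
    (f : E → F) : W →ₗ.[ℂ] V where
  domain :=
    { carrier := {h | ∃ g : V, ∀ x, g x = h (f x)}
      zero_mem' := ⟨0, fun x => by simp⟩
      add_mem' := by
        rintro h₁ h₂ ⟨g₁, e₁⟩ ⟨g₂, e₂⟩
        exact ⟨g₁ + g₂, fun x => by simp [e₁, e₂]⟩
      smul_mem' := by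
        rintro c h ⟨g, e⟩
        exact ⟨c • g, fun x => by simp [e]⟩ }
  toFun :=
    { toFun := fun h => Classical.choose h.2
      map_add' := fun h₁ h₂ => RKHS.ext fun x => by
        have e₁ := Classical.choose_spec h₁.2 x
        have e₂ := Classical.choose_spec h₂.2 x
        refine (Classical.choose_spec (h₁ + h₂).2 x).trans ?_
        simp only [RKHS.coe_add, Pi.add_apply, e₁, e₂, Submodule.coe_add]
      map_smul' := fun c h => RKHS.ext fun x => by
        have e₁ := Classical.choose_spec h.2 x
        refine (Classical.choose_spec (c • h).2 x).trans ?_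
        simp only [RKHS.coe_smul, Pi.smul_apply, e₁, Submodule.coe_smul, RingHom.id_apply] }

theorem compositionOperator_apply {E F : Type*} (W V : Type*)
    [NormedAddCommGroup W] [InnerProductSpace ℂ W] [RKHS ℂ W F ℂ]
    [NormedAddCommGroup V] [InnerProductSpace ℂ V] [RKHS ℂ V E ℂ]
    (f : E → F) (h : (compositionOperator W V f).domain) (x : E) :
    compositionOperator W V f h x = (h : W) (f x) :=
  Classical.choose_spec h.2 x

/-- A partially defined operator is bounded on its domain. -/
def LinearPMap.IsBoundedOnDomain {W V : Type*}
    [NormedAddCommGroup W] [InnerProductSpace ℂ W]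
    [NormedAddCommGroup V] [InnerProductSpace ℂ V] (T : W →ₗ.[ℂ] V) : Prop :=
  ∃ M : ℝ, ∀ h : T.domain, ‖T h‖ ≤ M * ‖(h : W)‖

/-! ### Translation-invariant kernels, the spectral weight and its conditions -/

/-- The kernel `k(x, y) = u(x - y)`. -/
def translationKernel {d : ℕ} (u : EuclideanSpace ℝ (Fin d) → ℂ) :
    Matrix (EuclideanSpace ℝ (Fin d)) (EuclideanSpace ℝ (Fin d)) ℂ :=
  Matrix.of fun x y => u (x - y)

/-- The restriction of a kernel to a subset. -/
def restrictKernel {X : Type*} (k : Matrix X X ℂ) (U : Set X) : Matrix U U ℂ :=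
  k.submatrix Subtype.val Subtype.val

theorem restrictKernel_posSemidef {X : Type*} {k : Matrix X X ℂ} (hk : k.PosSemidef) (U : Set X) :
    (restrictKernel k U).PosSemidef :=
  hk.submatrix Subtype.val

/-- The Fourier transform of a square-integrable function `u` on `ℝ^d` (a representative of the
class in `L²`), with the normalization `û(ξ) = ∫ u(x) exp(-2πi x·ξ) dx`. -/
noncomputable def fourierL2 {d : ℕ} (u : EuclideanSpace ℝ (Fin d) → ℂ) (hu : MemLp u 2 volume) :
    EuclideanSpace ℝ (Fin d) → ℂ :=
  (𝓕 (hu.toLp u) : Lp ℂ 2 (volume : Measure (EuclideanSpace ℝ (Fin d))))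

/-- The norm `(∫ |h|² w)^(1/2)` of `L²(w)`, for a weight `w` with (almost everywhere)
nonnegative real values; the value is `∞` if `h` is not in `L²(w)`. -/
noncomputable def weightedNorm {d : ℕ} (w h : EuclideanSpace ℝ (Fin d) → ℂ) : ℝ≥0∞ :=
  (∫⁻ ξ, ‖h ξ‖ₑ ^ 2 * ENNReal.ofReal (w ξ).re) ^ (1 / 2 : ℝ)

/-- A complex polynomial as a function of the real variables `ξ_1, …, ξ_d`. -/
noncomputable def polyFun {d : ℕ} (P : MvPolynomial (Fin d) ℂ) :
    EuclideanSpace ℝ (Fin d) → ℂ :=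
  fun ξ => MvPolynomial.eval (fun i => (ξ i : ℂ)) P

/-- Multiplication by `ξ ↦ exp(-2πi zᵀξ)`, for `z ∈ ℂ^d`. -/
noncomputable def expMul {d : ℕ} (z : Fin d → ℂ) (h : EuclideanSpace ℝ (Fin d) → ℂ) :
    EuclideanSpace ℝ (Fin d) → ℂ :=
  fun ξ => Complex.exp (-2 * Real.pi * Complex.I * ∑ i, z i * (ξ i : ℂ)) * h ξ

/-- The norm in `L²(w)` of the restriction of the multiplication operator `m_z` to the space of
polynomials of total degree at most `n`. -/
noncomputable def expMulPolyNorm {d : ℕ} (w : EuclideanSpace ℝ (Fin d) → ℂ) (z : Fin d → ℂ)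
    (n : ℕ) : ℝ≥0∞ :=
  ⨆ (P : MvPolynomial (Fin d) ℂ) (_ : P.totalDegree ≤ n) (_ : P ≠ 0),
    weightedNorm w (expMul z (polyFun P)) / weightedNorm w (polyFun P)

/-- The weight decays faster than every exponential. -/
def HasSuperexponentialDecay {d : ℕ} (w : EuclideanSpace ℝ (Fin d) → ℂ) : Prop :=
  ∀ a : ℝ, 0 < a → ∃ c : ℝ, 0 < c ∧ ∀ᵐ ξ, ‖w ξ‖ ≤ c * Real.exp (-a * ‖ξ‖)

/-- The growth condition on the norms of the operators `m_z` on polynomials. -/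
def HasPolynomialGrowthBound {d : ℕ} (w : EuclideanSpace ℝ (Fin d) → ℂ) : Prop :=
  (⨆ z : Fin d → ℂ, limsup (fun n : ℕ => expMulPolyNorm w z n ^ (1 / (n : ℝ))) atTop) < ∞

/-- The set of the `A ∈ GL_d(ℝ)` such that, for some `c > 0`, `w(Aᵀ ξ) ≥ c w(ξ)` for almost
every `ξ`, for a weight `w` with (almost everywhere) nonnegative real values. -/
def admissibleMatrices {d : ℕ} (w : EuclideanSpace ℝ (Fin d) → ℂ) :
    Set (Matrix (Fin d) (Fin d) ℝ) :=
  {A | IsUnit A ∧ ∃ c : ℝ, 0 < c ∧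
    ∀ᵐ ξ, c * (w ξ).re ≤ (w (Matrix.toEuclideanLin A.transpose ξ)).re}

/-! Let `μ` be the measure with density `û`, and for `z ∈ ℂ^d` let `e_z` be the exponential `ξ ↦
exp(-2πi zᵀξ)` in `L²(μ)`; by (A), `z ↦ e_z` is entire. Fourier inversion gives `k(x, y) = ⟨e_x,
e_y⟩`. Passing to adjoints, `C_f` is everywhere defined and bounded exactly when some bounded `T` on
`L²(μ)` satisfies `T e_x = e_{f(x)}` for `x ∈ U` (`compositionOperator_bounded_iff`). If `f(x) = Ax
+ b`, this says that the image of `μ` under `Aᵀ` is at most a multiple of `μ`, that is, `A ∈ 𝒢(u)`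
(`admissibleMatrices_eq`).

The substance is that such an `f` must be affine. As `z ↦ e_z` is an injective holomorphic
immersion, `f` extends near a point of `U` to a holomorphic `F` with `T e_z = e_{F(z)}`.
Differentiating `n` times, `T` maps `e_z P`, where `P` has leading part `(vᵀξ)ⁿ`, to `e_{F(z)} Q`,
where `Q` has leading part `((DF(z)v)ᵀξ)ⁿ`. By (B) the exponential factors can be removed at a cost
of `Cⁿ` each, and the substitution `ξ ↦ Aᵀξ` with `A ∈ 𝒢(u)` costs a factor independent of `n`. If
`A DF(z) v = νv`, comparing distances to the polynomials of lower degree gives `|ν|ⁿ ≤ const · C²ⁿ`,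
hence `|ν| ≤ C²` (`norm_eigenvalue_le`). So the traces of `A DF(z)` are bounded, and since `𝒢(u)`
spans by (C), `DF(z)` is bounded uniformly in `T`, `F` and `z` (`exists_norm_fderiv_le`).

With this bound, continuation of `F` along segments never breaks down
(`exists_differentiable_lift`), and Liouville's theorem makes the entire lift affine. Then `T e_x =
e_{Ax+b}` on all of `ℝ^d`, and density of exponential sums yields `A ∈ 𝒢(u)`
(`mem_dominatedMatrices_of_affine`). -/

section Hilbert

/-! ### Feature maps and the adjoint description of bounded composition operators. -/

variable {X H₁ H₂ : Type*} [NormedAddCommGroup H₁] [InnerProductSpace ℂ H₁] [CompleteSpace H₁]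
  [NormedAddCommGroup H₂] [InnerProductSpace ℂ H₂] [CompleteSpace H₂]

/-- A norm inequality between all finite combinations of two families yields a bounded operator
mapping one family to the other. -/
theorem exists_clm_of_norm_linearCombination_le (a : X → H₁) (b : X → H₂) (M : ℝ)
    (h : ∀ c : X →₀ ℂ, ‖Finsupp.linearCombination ℂ a c‖ ≤ M * ‖Finsupp.linearCombination ℂ b c‖) :
    ∃ T : H₂ →L[ℂ] H₁, ∀ x, T (b x) = a x := by
  -- The inequality makes `∑ c b ↦ ∑ c a` well defined and bounded on the span of `b`. It extends to
  -- the closure `S`, and then by zero on the orthogonal complement of `S`.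
  let S : Submodule ℂ H₂ := (LinearMap.range (Finsupp.linearCombination ℂ b)).topologicalClosure
  have hmem : ∀ c, Finsupp.linearCombination ℂ b c ∈ S := fun c =>
    Submodule.le_topologicalClosure _ ⟨c, rfl⟩
  let e : (X →₀ ℂ) →ₗ[ℂ] S := (Finsupp.linearCombination ℂ b).codRestrict S hmem
  have hdense : DenseRange e := by
    intro y
    rw [mem_closure_iff_nhds]
    intro t ht
    obtain ⟨o, ho, hot⟩ := mem_nhds_subtype _ _ _ |>.1 ht
    have hy : (y : H₂) ∈ closure (LinearMap.range (Finsupp.linearCombination ℂ b) : Set H₂) := y.2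
    obtain ⟨_, hz, ⟨c, rfl⟩⟩ := mem_closure_iff_nhds.1 hy o ho
    exact ⟨e c, hot hz, ⟨c, rfl⟩⟩
  have : CompleteSpace S := (Submodule.isClosed_topologicalClosure _).completeSpace_coe
  let T₀ : S →L[ℂ] H₁ := (Finsupp.linearCombination ℂ a).extendOfNorm e
  refine ⟨T₀.comp S.orthogonalProjectionOnto, fun x => ?_⟩
  have h1 : b x = (e (Finsupp.single x 1) : H₂) := by simp [e]
  have h2 : T₀ (e (Finsupp.single x 1)) = Finsupp.linearCombination ℂ a (Finsupp.single x 1) :=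
    LinearMap.extendOfNorm_eq hdense ⟨M, fun c => by simpa [e] using h c⟩ _
  rw [ContinuousLinearMap.comp_apply, h1, Submodule.orthogonalProjectionOnto_mem_subspace_eq_self, h2]
  simp

end Hilbert

/-- The Gram matrix determines all norms of combinations. This carries inequalities between kernel
functions over to feature vectors and back. -/
theorem norm_linearCombination_eq_of_inner_eq {X H₁ H₂ : Type*} [NormedAddCommGroup H₁]
    [InnerProductSpace ℂ H₁] [NormedAddCommGroup H₂] [InnerProductSpace ℂ H₂]
    {a : X → H₁} {b : X → H₂}
    (h : ∀ x y, inner ℂ (a x) (a y) = inner ℂ (b x) (b y)) (c : X →₀ ℂ) :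
    ‖Finsupp.linearCombination ℂ a c‖ = ‖Finsupp.linearCombination ℂ b c‖ := by
  have key : inner ℂ (Finsupp.linearCombination ℂ a c) (Finsupp.linearCombination ℂ a c) =
      inner ℂ (Finsupp.linearCombination ℂ b c) (Finsupp.linearCombination ℂ b c) := by
    simp only [Finsupp.linearCombination_apply, Finsupp.sum, sum_inner, inner_sum, inner_smul_left,
      inner_smul_right, h]
  rw [inner_self_eq_norm_sq_to_K, inner_self_eq_norm_sq_to_K] at key
  exact (sq_eq_sq₀ (norm_nonneg _) (norm_nonneg _)).1 (by exact_mod_cast key)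

theorem posSemidef_of_inner {X H : Type*} [NormedAddCommGroup H] [InnerProductSpace ℂ H]
    {k : Matrix X X ℂ} (Φ : X → H) (hΦ : ∀ x y, k x y = inner ℂ (Φ x) (Φ y)) : k.PosSemidef := by
  refine ⟨by ext x y; simp [hΦ], fun c => ?_⟩
  have key : (c.sum fun i xi => c.sum fun j xj => star xi * k i j * xj) =
      inner ℂ (Finsupp.linearCombination ℂ Φ c) (Finsupp.linearCombination ℂ Φ c) := by
    simp only [Finsupp.linearCombination_apply, Finsupp.sum, sum_inner, inner_sum, inner_smul_left,
      inner_smul_right, hΦ]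
    rw [Finset.sum_comm]
    refine Finset.sum_congr rfl fun i _ => ?_
    rw [Finset.mul_sum]
    refine Finset.sum_congr rfl fun j _ => ?_
    rw [Complex.star_def]
    ring
  rw [key, inner_self_eq_norm_sq_to_K]
  positivity

/-- For a kernel with feature map `Φ`, the composition operator with symbol `f` is everywhere
defined and bounded if and only if `Φ x ↦ Φ (f x)` extends to a bounded operator. -/
theorem compositionOperator_bounded_iff {X H : Type*} [NormedAddCommGroup H]
    [InnerProductSpace ℂ H] [CompleteSpace H] {k : Matrix X X ℂ} (hk : k.PosSemidef) (Φ : X → H)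
    (hΦ : ∀ x y, k x y = inner ℂ (Φ x) (Φ y)) (U : Set X) (f : U → X) :
    ((compositionOperator (KernelSpace k hk)
        (KernelSpace (restrictKernel k U) (restrictKernel_posSemidef hk U)) f).domain = ⊤ ∧
      (compositionOperator (KernelSpace k hk)
        (KernelSpace (restrictKernel k U) (restrictKernel_posSemidef hk U)) f).IsBoundedOnDomain) ↔
    ∃ T : H →L[ℂ] H, ∀ x : U, T (Φ x) = Φ (f x) := by
  set V := KernelSpace k hk
  set W := KernelSpace (restrictKernel k U) (restrictKernel_posSemidef hk U)
  set L := compositionOperator V W f with hL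
  choose κ hκ hκi using KernelSpace.exists_reproducing k hk
  choose κU hκU hκUi using
    KernelSpace.exists_reproducing (restrictKernel k U) (restrictKernel_posSemidef hk U)
  have hV : ∀ c : U →₀ ℂ, ‖Finsupp.linearCombination ℂ (fun x => κ (f x)) c‖ =
      ‖Finsupp.linearCombination ℂ (fun x => Φ (f x)) c‖ :=
    norm_linearCombination_eq_of_inner_eq fun x y => by rw [hκi, hκ, hΦ]
  have hW : ∀ c : U →₀ ℂ, ‖Finsupp.linearCombination ℂ κU c‖ =
      ‖Finsupp.linearCombination ℂ (fun x : U => Φ x) c‖ :=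
    norm_linearCombination_eq_of_inner_eq fun x y => by
      rw [hκUi, hκU]; simp [restrictKernel, hΦ]
  constructor
  · rintro ⟨hdom, M, hM⟩
    let Lc : V →L[ℂ] W := LinearMap.mkContinuous
      (L.toFun ∘ₗ (LinearMap.id.codRestrict L.domain fun x => by rw [hdom]; trivial)) M
      fun x => hM ⟨x, by rw [hdom]; trivial⟩
    have hLc : ∀ (h : V) (x : U), Lc h x = h (f x) := fun h x =>
      compositionOperator_apply V W f ⟨h, by rw [← hL, hdom]; trivial⟩ x
    -- By the reproducing property the adjoint of composition acts on kernel functions as `k_x ↦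
    -- k_{f(x)}`, which is the form that transfers to `Φ`.
    have hadj : ∀ x, Lc.adjoint (κU x) = κ (f x) := fun x => by
      refine ext_inner_right ℂ fun h => ?_
      rw [ContinuousLinearMap.adjoint_inner_left, hκUi, hκi, hLc]
    refine exists_clm_of_norm_linearCombination_le _ _ ‖Lc.adjoint‖ fun c => ?_
    rw [← hV, ← hW]
    have : Finsupp.linearCombination ℂ (fun x => κ (f x)) c =
        Lc.adjoint (Finsupp.linearCombination ℂ κU c) := by
      simp [Finsupp.linearCombination_apply, Finsupp.sum, hadj]
    rw [this]
    exact Lc.adjoint.le_opNorm _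
  · rintro ⟨T, hT⟩
    obtain ⟨R, hR⟩ := exists_clm_of_norm_linearCombination_le (fun x => κ (f x)) κU ‖T‖ fun c => by
      rw [hV, hW]
      have : Finsupp.linearCombination ℂ (fun x => Φ (f x)) c =
          T (Finsupp.linearCombination ℂ (fun x : U => Φ x) c) := by
        simp [Finsupp.linearCombination_apply, Finsupp.sum, hT]
      rw [this]
      exact T.le_opNorm _
    have hRa : ∀ (h : V) (x : U), R.adjoint h x = h (f x) := fun h x => by
      rw [← hκUi, ContinuousLinearMap.adjoint_inner_right, hR, hκi]
    refine ⟨eq_top_iff.2 fun h _ => ⟨R.adjoint h, hRa h⟩, ‖R.adjoint‖, fun h => ?_⟩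
    have : L h = R.adjoint (h : V) := RKHS.ext fun x => by
      rw [hRa]; exact compositionOperator_apply V W f h x
    rw [this]
    exact R.adjoint.le_opNorm _

/-! ### Exponential polynomials in `L²(μ)` and their Taylor expansion in the frequency. -/

section ExponentialPolynomials

variable {d : ℕ}

/-- All exponential moments of the measure are finite. -/
def HasExpMoments (μ : Measure (EuclideanSpace ℝ (Fin d))) : Prop :=
  ∀ a : ℝ, Integrable (fun ξ => Real.exp (a * ‖ξ‖)) μ

/-- The linear form `ξ ↦ ∑ vᵢ ξᵢ` as a polynomial. -/
noncomputable def linearForm (v : Fin d → ℂ) : MvPolynomial (Fin d) ℂ :=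
  ∑ i, MvPolynomial.C (v i) * MvPolynomial.X i

/-- The complexification of a real vector. -/
def complexify (x : EuclideanSpace ℝ (Fin d)) : Fin d → ℂ := fun i => (x i : ℂ)

theorem polyFun_linearForm (v : Fin d → ℂ) (ξ : EuclideanSpace ℝ (Fin d)) :
    polyFun (linearForm v) ξ = ∑ i, v i * (ξ i : ℂ) := by
  simp [polyFun, linearForm]

theorem polyFun_one : polyFun (1 : MvPolynomial (Fin d) ℂ) = fun _ => 1 := by
  ext; simp [polyFun]

theorem polyFun_mul (P Q : MvPolynomial (Fin d) ℂ) (ξ : EuclideanSpace ℝ (Fin d)) :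
    polyFun (P * Q) ξ = polyFun P ξ * polyFun Q ξ := by simp [polyFun]

theorem polyFun_pow (P : MvPolynomial (Fin d) ℂ) (n : ℕ) (ξ : EuclideanSpace ℝ (Fin d)) :
    polyFun (P ^ n) ξ = polyFun P ξ ^ n := by simp [polyFun]

theorem polyFun_add (P Q : MvPolynomial (Fin d) ℂ) (ξ : EuclideanSpace ℝ (Fin d)) :
    polyFun (P + Q) ξ = polyFun P ξ + polyFun Q ξ := by simp [polyFun]

theorem polyFun_smul (c : ℂ) (P : MvPolynomial (Fin d) ℂ) (ξ : EuclideanSpace ℝ (Fin d)) :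
    polyFun (c • P) ξ = c * polyFun P ξ := by simp [polyFun]

theorem continuous_polyFun (P : MvPolynomial (Fin d) ℂ) : Continuous (polyFun P) := by
  unfold polyFun
  exact (MvPolynomial.continuous_eval P).comp (by fun_prop)

theorem linearForm_smul (c : ℂ) (v : Fin d → ℂ) : linearForm (c • v) = c • linearForm v := by
  simp [linearForm, Finset.smul_sum, MvPolynomial.smul_eq_C_mul, mul_assoc]

theorem totalDegree_linearForm_le (v : Fin d → ℂ) : (linearForm v).totalDegree ≤ 1 := by
  refine MvPolynomial.totalDegree_finsetSum_le fun i _ => ?_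
  refine (MvPolynomial.totalDegree_mul _ _).trans ?_
  simp

theorem totalDegree_linearForm_pow_le (v : Fin d → ℂ) (n : ℕ) :
    (linearForm v ^ n).totalDegree ≤ n :=
  (MvPolynomial.totalDegree_pow _ _).trans 
    ((Nat.mul_le_mul_left n (totalDegree_linearForm_le v)).trans_eq (mul_one n))

theorem norm_polyFun_linearForm_le (v : Fin d → ℂ) (ξ : EuclideanSpace ℝ (Fin d)) :
    ‖polyFun (linearForm v) ξ‖ ≤ d * ‖v‖ * ‖ξ‖ := by
  rw [polyFun_linearForm]
  refine (norm_sum_le _ _).trans ?_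
  calc ∑ i, ‖v i * (ξ i : ℂ)‖ ≤ ∑ _i : Fin d, ‖v‖ * ‖ξ‖ := by
        refine Finset.sum_le_sum fun i _ => ?_
        rw [norm_mul, Complex.norm_real]
        exact mul_le_mul (norm_le_pi_norm v i) (PiLp.norm_apply_le ξ i) (norm_nonneg _)
          (norm_nonneg _)
    _ = d * ‖v‖ * ‖ξ‖ := by simp [mul_assoc]

theorem exists_norm_polyFun_le (P : MvPolynomial (Fin d) ℂ) :
    ∃ C a : ℝ, 0 ≤ C ∧ ∀ ξ, ‖polyFun P ξ‖ ≤ C * Real.exp (a * ‖ξ‖) := by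
  induction P using MvPolynomial.induction_on with
  | C c => exact ⟨‖c‖, 0, norm_nonneg _, fun ξ => by simp [polyFun]⟩
  | add P Q hP hQ =>
    obtain ⟨C, a, hC, h⟩ := hP
    obtain ⟨C', a', hC', h'⟩ := hQ
    refine ⟨C + C', max a a', by positivity, fun ξ => ?_⟩
    rw [polyFun_add, add_mul]
    refine (norm_add_le _ _).trans (add_le_add ((h ξ).trans ?_) ((h' ξ).trans ?_))
    · gcongr; exact le_max_left _ _
    · gcongr; exact le_max_right _ _
  | mul_X P i hP =>
    obtain ⟨C, a, hC, h⟩ := hP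
    refine ⟨C, a + 1, hC, fun ξ => ?_⟩
    rw [polyFun_mul, norm_mul, add_mul, Real.exp_add, one_mul, ← mul_assoc]
    refine mul_le_mul (h ξ) ?_ (norm_nonneg _) (by positivity)
    have h1 : ‖polyFun (MvPolynomial.X i) ξ‖ = ‖ξ i‖ := by simp [polyFun]
    rw [h1]
    exact (PiLp.norm_apply_le ξ i).trans
      ((le_add_of_nonneg_right zero_le_one).trans (Real.add_one_le_exp _))

theorem expMul_eq (z : Fin d → ℂ) (h : EuclideanSpace ℝ (Fin d) → ℂ)
    (ξ : EuclideanSpace ℝ (Fin d)) :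
    expMul z h ξ = Complex.exp (-2 * Real.pi * Complex.I * polyFun (linearForm z) ξ) * h ξ := by
  rw [polyFun_linearForm]; rfl

theorem continuous_expMul (z : Fin d → ℂ) {h : EuclideanSpace ℝ (Fin d) → ℂ} (hh : Continuous h) :
    Continuous (expMul z h) := by
  have := continuous_polyFun (linearForm z)
  rw [show expMul z h = fun ξ => Complex.exp (-2 * Real.pi * Complex.I *
    polyFun (linearForm z) ξ) * h ξ from funext (expMul_eq z h)]
  fun_prop

theorem norm_two_pi_I_mul (s : ℂ) : ‖-2 * Real.pi * Complex.I * s‖ = 2 * Real.pi * ‖s‖ := by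
  simp [abs_of_pos Real.pi_pos]

theorem norm_expMul_le (z : Fin d → ℂ) (h : EuclideanSpace ℝ (Fin d) → ℂ)
    (ξ : EuclideanSpace ℝ (Fin d)) :
    ‖expMul z h ξ‖ ≤ Real.exp (2 * Real.pi * (d * ‖z‖) * ‖ξ‖) * ‖h ξ‖ := by
  rw [expMul_eq, norm_mul]
  gcongr
  refine (Complex.norm_exp_le_exp_norm _).trans (Real.exp_le_exp.2 ?_)
  rw [norm_two_pi_I_mul, mul_assoc (2 * Real.pi)]
  gcongr
  exact norm_polyFun_linearForm_le z ξ

theorem HasExpMoments.memLp {μ : Measure (EuclideanSpace ℝ (Fin d))} (hμ : HasExpMoments μ)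
    {F : Type*} [NormedAddCommGroup F] {h : EuclideanSpace ℝ (Fin d) → F}
    (hh : AEStronglyMeasurable h μ) {C a : ℝ}
    (hb : ∀ ξ, ‖h ξ‖ ≤ C * Real.exp (a * ‖ξ‖)) : MemLp h 2 μ := by
  have h1 : MemLp (fun ξ : EuclideanSpace ℝ (Fin d) => Real.exp (a * ‖ξ‖)) 2 μ := by
    rw [memLp_two_iff_integrable_sq (by fun_prop)]
    refine (hμ (2 * a)).congr (.of_forall fun ξ => ?_)
    beta_reduce
    rw [← Real.exp_nat_mul]
    push_cast
    ring_nf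
  exact (h1.const_mul C).mono hh (.of_forall fun ξ => (hb ξ).trans (le_abs_self _))

theorem HasExpMoments.memLp_expMul_polyFun {μ : Measure (EuclideanSpace ℝ (Fin d))}
    (hμ : HasExpMoments μ) (z : Fin d → ℂ) (P : MvPolynomial (Fin d) ℂ) :
    MemLp (expMul z (polyFun P)) 2 μ := by
  obtain ⟨C, a, hC, h⟩ := exists_norm_polyFun_le P
  refine hμ.memLp (continuous_expMul z (continuous_polyFun P)).aestronglyMeasurable
    (C := C) (a := 2 * Real.pi * (d * ‖z‖) + a) fun ξ => ?_
  refine (norm_expMul_le z _ ξ).trans ?_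
  calc _ ≤ Real.exp (2 * Real.pi * (d * ‖z‖) * ‖ξ‖) * (C * Real.exp (a * ‖ξ‖)) := by
        gcongr; exact h ξ
    _ = _ := by rw [add_mul, Real.exp_add]; ring

/-- The function `ξ ↦ exp(-2πi zᵀξ) P(ξ)` as an element of `L²(μ)`. -/
noncomputable def expPoly {μ : Measure (EuclideanSpace ℝ (Fin d))} (hμ : HasExpMoments μ)
    (z : Fin d → ℂ) : MvPolynomial (Fin d) ℂ →ₗ[ℂ] Lp ℂ 2 μ where
  toFun P := (hμ.memLp_expMul_polyFun z P).toLp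
  map_add' P Q := by
    rw [← MemLp.toLp_add]
    refine MemLp.toLp_congr _ _ (.of_forall fun ξ => ?_)
    simp only [expMul_eq, polyFun_add, Pi.add_apply]
    ring
  map_smul' c P := by
    rw [RingHom.id_apply, ← MemLp.toLp_const_smul]
    refine MemLp.toLp_congr _ _ (.of_forall fun ξ => ?_)
    simp only [expMul_eq, polyFun_smul, Pi.smul_apply, smul_eq_mul]
    ring

variable {μ : Measure (EuclideanSpace ℝ (Fin d))} (hμ : HasExpMoments μ)

theorem coeFn_expPoly (z : Fin d → ℂ) (P : MvPolynomial (Fin d) ℂ) :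
    expPoly hμ z P =ᵐ[μ] expMul z (polyFun P) :=
  (hμ.memLp_expMul_polyFun z P).coeFn_toLp

theorem inner_expPoly (z w : Fin d → ℂ) (P Q : MvPolynomial (Fin d) ℂ) :
    inner ℂ (expPoly hμ z P) (expPoly hμ w Q) =
      ∫ ξ, expMul w (polyFun Q) ξ * star (expMul z (polyFun P) ξ) ∂μ := by
  rw [L2.inner_def]
  refine integral_congr_ae ?_
  filter_upwards [coeFn_expPoly hμ z P, coeFn_expPoly hμ w Q] with ξ h1 h2
  rw [h1, h2]
  simp

/-- The Taylor expansion of `z ↦ exp(-2πi zᵀξ) P(ξ)` in `L²(μ)`. -/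
theorem exists_norm_expPoly_sub_sum_le (z : Fin d → ℂ) (P : MvPolynomial (Fin d) ℂ) (n : ℕ) :
    ∃ C : ℝ, ∀ y : Fin d → ℂ, ‖y‖ ≤ 1 →
      ‖expPoly hμ (z + y) P - ∑ k ∈ Finset.range n,
        ((-2 * Real.pi * Complex.I) ^ k / k.factorial) • expPoly hμ z (linearForm y ^ k * P)‖ ≤
      C * ‖y‖ ^ n := by
  obtain ⟨C, a, hC, hP⟩ := exists_norm_polyFun_le P
  -- The exponential remainder at `s = -2πi yᵀξ` is at most `‖s‖ⁿ exp ‖s‖`, with `‖s‖ ≤ 2πd ‖ξ‖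
  -- ‖y‖`. Pulling out `‖y‖ⁿ` and using `‖y‖ ≤ 1` in the exponent leaves `h`, whose `L²` norm is the
  -- constant.
  let h : EuclideanSpace ℝ (Fin d) → ℝ := fun ξ =>
    (2 * Real.pi * d * ‖ξ‖) ^ n * Real.exp (2 * Real.pi * d * ‖ξ‖) * ‖expMul z (polyFun P) ξ‖
  have hh : MemLp h 2 μ := by
    have := continuous_expMul z (continuous_polyFun P)
    refine hμ.memLp (by fun_prop) (C := n.factorial * C)
      (a := 2 * Real.pi * d + 2 * Real.pi * d + (2 * Real.pi * (d * ‖z‖) + a)) fun ξ => ?_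
    rw [Real.norm_of_nonneg (by positivity)]
    have h1 : (2 * Real.pi * d * ‖ξ‖) ^ n ≤ n.factorial * Real.exp (2 * Real.pi * d * ‖ξ‖) := by
      have := Real.pow_div_factorial_le_exp (2 * Real.pi * d * ‖ξ‖) (by positivity) n
      rwa [div_le_iff₀' (by positivity)] at this
    have h2 : ‖expMul z (polyFun P) ξ‖ ≤
        Real.exp (2 * Real.pi * (d * ‖z‖) * ‖ξ‖) * (C * Real.exp (a * ‖ξ‖)) :=
      (norm_expMul_le z _ ξ).trans (by gcongr; exact hP ξ)
    calc h ξ ≤ (n.factorial * Real.exp (2 * Real.pi * d * ‖ξ‖)) *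
          Real.exp (2 * Real.pi * d * ‖ξ‖) *
          (Real.exp (2 * Real.pi * (d * ‖z‖) * ‖ξ‖) * (C * Real.exp (a * ‖ξ‖))) := by
            simp only [h]; gcongr
      _ = _ := by simp only [add_mul, Real.exp_add]; ring
  refine ⟨‖hh.toLp h‖, fun y hy => ?_⟩
  rw [mul_comm ‖hh.toLp h‖]
  refine Lp.norm_le_mul_norm_of_ae_le_mul (g := hh.toLp h) ?_
  have hsum : ∀ s : Finset ℕ, ∀ᵐ ξ ∂μ, (∑ k ∈ s,
      ((-2 * Real.pi * Complex.I) ^ k / k.factorial) • expPoly hμ z (linearForm y ^ k * P) :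
        Lp ℂ 2 μ) ξ = ∑ k ∈ s, ((-2 * Real.pi * Complex.I) ^ k / k.factorial) *
          expMul z (polyFun (linearForm y ^ k * P)) ξ := fun s => by
    have := (ae_all_iff (ι := s)).2 fun k => coeFn_expPoly hμ z (linearForm y ^ (k : ℕ) * P)
    have h2 := (ae_all_iff (ι := s)).2 fun k => Lp.coeFn_smul (p := 2) (μ := μ)
      ((-2 * Real.pi * Complex.I) ^ (k : ℕ) / (k : ℕ).factorial)
      (expPoly hμ z (linearForm y ^ (k : ℕ) * P))
    let g : ℕ → Lp ℂ 2 μ := fun k =>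
      ((-2 * Real.pi * Complex.I) ^ k / k.factorial : ℂ) • expPoly hμ z (linearForm y ^ k * P)
    filter_upwards [this, h2, Lp.coeFn_fun_finsetSum s g] with ξ h1 h2 h3
    rw [h3]
    refine Finset.sum_congr rfl fun k hk => ?_
    rw [h2 ⟨k, hk⟩, Pi.smul_apply, h1 ⟨k, hk⟩, smul_eq_mul]
  filter_upwards [Lp.coeFn_sub (expPoly hμ (z + y) P) (∑ k ∈ Finset.range n,
        ((-2 * Real.pi * Complex.I) ^ k / k.factorial) • expPoly hμ z (linearForm y ^ k * P)),
    hsum (Finset.range n), coeFn_expPoly hμ (z + y) P, hh.coeFn_toLp] with ξ h1 h2 h3 h4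
  rw [h1, Pi.sub_apply, h2, h3, h4]
  set s : ℂ := -2 * Real.pi * Complex.I * polyFun (linearForm y) ξ with hs
  have hsn : ‖s‖ ≤ 2 * Real.pi * d * ‖ξ‖ * ‖y‖ := by
    rw [hs, norm_two_pi_I_mul]
    calc _ ≤ 2 * Real.pi * (d * ‖y‖ * ‖ξ‖) := by gcongr; exact norm_polyFun_linearForm_le y ξ
      _ = _ := by ring
  have hadd : polyFun (linearForm (z + y)) ξ =
      polyFun (linearForm z) ξ + polyFun (linearForm y) ξ := by
    simp [polyFun_linearForm, add_mul, Finset.sum_add_distrib]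
  have : expMul (z + y) (polyFun P) ξ - ∑ k ∈ Finset.range n,
      ((-2 * Real.pi * Complex.I) ^ k / k.factorial) *
        expMul z (polyFun (linearForm y ^ k * P)) ξ =
      (Complex.exp s - ∑ k ∈ Finset.range n, s ^ k / k.factorial) * expMul z (polyFun P) ξ := by
    rw [sub_mul, Finset.sum_mul]
    congr 1
    · rw [expMul_eq, expMul_eq, hadd, mul_add, Complex.exp_add, hs]; ring
    · refine Finset.sum_congr rfl fun k _ => ?_
      rw [expMul_eq, expMul_eq, polyFun_mul, polyFun_pow, hs, mul_pow]; ring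
  rw [this, norm_mul, Real.norm_of_nonneg (show 0 ≤ h ξ by positivity)]
  calc _ ≤ (‖s‖ ^ n * Real.exp ‖s‖) * ‖expMul z (polyFun P) ξ‖ := by
        gcongr; exact Complex.norm_exp_sub_sum_le_norm_mul_exp s n
    _ ≤ ((2 * Real.pi * d * ‖ξ‖ * ‖y‖) ^ n * Real.exp (2 * Real.pi * d * ‖ξ‖)) *
        ‖expMul z (polyFun P) ξ‖ := by
        gcongr
        exact hsn.trans (mul_le_of_le_one_right (by positivity) hy)
    _ = ‖y‖ ^ n * h ξ := by simp only [h]; ring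

end ExponentialPolynomials

/-! ### The family of exponentials as an injective holomorphic immersion. -/

section ExponentialFamily

variable {d : ℕ} {μ : Measure (EuclideanSpace ℝ (Fin d))} (hμ : HasExpMoments μ)

/-- This is the Taylor estimate with two terms: the error is quadratic in the increment. -/
theorem hasFDerivAt_expPoly (P : MvPolynomial (Fin d) ℂ) (z : Fin d → ℂ) :
    HasFDerivAt (fun z => expPoly hμ z P)
      (∑ i, (ContinuousLinearMap.proj (R := ℂ) (φ := fun _ : Fin d => ℂ) i).smulRight
        ((-2 * Real.pi * Complex.I : ℂ) • expPoly hμ z (MvPolynomial.X i * P))) z := by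
  obtain ⟨C, hC⟩ := exists_norm_expPoly_sub_sum_le hμ z P 2
  rw [hasFDerivAt_iff_isLittleO_nhds_zero]
  refine (Asymptotics.IsBigO.of_bound C ?_ :
    _ =O[𝓝 0] fun y : Fin d → ℂ => ‖y‖ ^ 2).trans_isLittleO ?_
  · filter_upwards [Metric.closedBall_mem_nhds (0 : Fin d → ℂ) one_pos] with y hy
    have := hC y (by simpa using hy)
    rw [norm_pow, norm_norm]
    refine le_trans (le_of_eq ?_) this
    rw [sub_sub]
    congr 2
    simp only [Finset.sum_range_succ, Finset.range_zero, Finset.sum_empty, zero_add, pow_zero,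
      pow_one, Nat.factorial_zero, Nat.factorial_one, Nat.cast_one, div_one, one_smul, one_mul,
      ← MvPolynomial.smul_eq_C_mul, map_sum, map_smul, Finset.smul_sum, linearForm, Finset.sum_mul,
      sum_apply, ContinuousLinearMap.smulRight_apply, ContinuousLinearMap.proj_apply,
      smul_mul_assoc]
    congr 1
    exact Finset.sum_congr rfl fun i _ => smul_comm _ _ _
  · exact Asymptotics.isLittleO_norm_pow_id one_lt_two

theorem continuous_expPoly (P : MvPolynomial (Fin d) ℂ) : Continuous fun z => expPoly hμ z P :=
  continuous_iff_continuousAt.2 fun z => (hasFDerivAt_expPoly hμ P z).continuousAt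

theorem fderiv_expPoly_one_apply (z v : Fin d → ℂ) :
    fderiv ℂ (fun z => expPoly hμ z 1) z v =
      (-2 * Real.pi * Complex.I : ℂ) • expPoly hμ z (linearForm v) := by
  rw [(hasFDerivAt_expPoly hμ 1 z).fderiv]
  simp only [linearForm, ← MvPolynomial.smul_eq_C_mul, map_sum, map_smul, Finset.smul_sum, mul_one,
    sum_apply, ContinuousLinearMap.smulRight_apply,
    ContinuousLinearMap.proj_apply]
  exact Finset.sum_congr rfl fun i _ => smul_comm _ _ _

/-- The partial derivatives are again exponential polynomials, hence continuous in `z`. Class `C¹`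
is what the inverse function theorem requires. -/
theorem contDiff_expPoly (P : MvPolynomial (Fin d) ℂ) : ContDiff ℂ 1 fun z => expPoly hμ z P := by
  refine contDiff_one_iff_hasFDerivAt.2 ⟨_, ?_, hasFDerivAt_expPoly hμ P⟩
  refine continuous_finsetSum _ fun i _ => ?_
  exact (ContinuousLinearMap.smulRightL ℂ (Fin d → ℂ) (Lp ℂ 2 μ)
    (ContinuousLinearMap.proj (R := ℂ) (φ := fun _ : Fin d => ℂ) i)).continuous.comp
      ((continuous_const_smul (-2 * Real.pi * Complex.I : ℂ)).comp
        (continuous_expPoly hμ (MvPolynomial.X i * P)) :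
        Continuous fun z => (-2 * Real.pi * Complex.I : ℂ) • expPoly hμ z (MvPolynomial.X i * P))

/-- A closed condition holds almost everywhere if along every line of a fixed direction it fails
only on a countable set. -/
theorem ae_of_countable_along_lines {s : Set (EuclideanSpace ℝ (Fin d))} (hs : IsClosed s)
    (a : EuclideanSpace ℝ (Fin d)) (h : ∀ ξ, {t : ℝ | ξ + t • a ∈ s}.Countable) :
    ∀ᵐ ξ, ξ ∉ s := by
  refine ae_mem_of_ae_add_linearMap_mem (LinearMap.toSpanSingleton ℝ _ a) volume volume
    hs.measurableSet.compl fun ξ => ?_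
  have := (h ξ).ae_notMem (volume : Measure ℝ)
  filter_upwards [this] with t ht
  exact fun h => ht (by simpa using h)

theorem polyFun_linearForm_add_smul (v : Fin d → ℂ) (ξ a : EuclideanSpace ℝ (Fin d)) (t : ℝ) :
    polyFun (linearForm v) (ξ + t • a) =
      polyFun (linearForm v) ξ + t * polyFun (linearForm v) a := by
  simp only [polyFun_linearForm, Finset.mul_sum, ← Finset.sum_add_distrib]
  refine Finset.sum_congr rfl fun i _ => ?_
  simp
  ring

theorem exists_polyFun_linearForm_ne_zero {v : Fin d → ℂ} (hv : v ≠ 0) :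
    ∃ a : EuclideanSpace ℝ (Fin d), polyFun (linearForm v) a ≠ 0 := by
  obtain ⟨i, hi⟩ := Function.ne_iff.1 hv
  refine ⟨EuclideanSpace.single i 1, ?_⟩
  rw [polyFun_linearForm, Finset.sum_eq_single i] <;> simp_all

/-- On each line in a direction `a` where the linear form does not vanish, the polynomial restricts
to one of degree exactly `n` in the parameter, since `Q` contributes lower degree. It thus has
finitely many zeros on the line. -/
theorem ae_polyFun_linearForm_pow_add_ne_zero {v : Fin d → ℂ} (hv : v ≠ 0) {n : ℕ}
    {Q : MvPolynomial (Fin d) ℂ} (hQ : Q.totalDegree < n) :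
    ∀ᵐ ξ : EuclideanSpace ℝ (Fin d), polyFun (linearForm v ^ n + Q) ξ ≠ 0 := by
  obtain ⟨a, ha⟩ := exists_polyFun_linearForm_ne_zero hv
  refine ae_of_countable_along_lines (isClosed_eq (continuous_polyFun _) continuous_const) a
    fun ξ => ?_
  let line : Fin d → Polynomial ℂ := fun i =>
    Polynomial.C (ξ i : ℂ) + Polynomial.C (a i : ℂ) * Polynomial.X
  let q : Polynomial ℂ := MvPolynomial.aeval line Q
  have hline : ∀ (R : MvPolynomial (Fin d) ℂ) (t : ℝ),
      polyFun R (ξ + t • a) = (MvPolynomial.aeval line R).eval (t : ℂ) := fun R t => by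
    induction R using MvPolynomial.induction_on with
    | C c => simp [polyFun]
    | add P Q hP hQ => rw [polyFun_add, hP, hQ, map_add, Polynomial.eval_add]
    | mul_X P i hP =>
      rw [polyFun_mul, hP, map_mul, Polynomial.eval_mul]
      congr 1
      simp [polyFun, line, mul_comm (a i : ℂ)]
  have hq : q.natDegree < n := by
    refine lt_of_le_of_lt (b := Q.totalDegree * 1) ?_ (by simpa using hQ)
    exact MvPolynomial.aeval_natDegree_le Q le_rfl line fun i => by
      simp only [line]
      compute_degree
  let p : Polynomial ℂ := (Polynomial.C (polyFun (linearForm v) ξ) +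
    Polynomial.C (polyFun (linearForm v) a) * Polynomial.X) ^ n
  have hp1 : (Polynomial.C (polyFun (linearForm v) ξ) +
    Polynomial.C (polyFun (linearForm v) a) * Polynomial.X).natDegree = 1 := by
    rw [add_comm]; exact Polynomial.natDegree_linear ha
  have hp : p.natDegree = n := by rw [Polynomial.natDegree_pow, hp1, mul_one]
  have hne : p + q ≠ 0 := fun h => by
    have := Polynomial.natDegree_add_eq_left_of_natDegree_lt (p := p) (q := q) (by rwa [hp])
    rw [h, hp, Polynomial.natDegree_zero] at this
    omega
  have heval : ∀ t : ℝ, polyFun (linearForm v ^ n + Q) (ξ + t • a) = (p + q).eval (t : ℂ) := by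
    intro t
    rw [polyFun_add, polyFun_pow, polyFun_linearForm_add_smul, Polynomial.eval_add]
    congr 1
    · simp only [p, Polynomial.eval_pow, Polynomial.eval_add, Polynomial.eval_mul,
        Polynomial.eval_C, Polynomial.eval_X]
      ring
    · exact hline Q t
  refine (((p + q).roots.toFinset.finite_toSet.preimage
    Complex.ofReal_injective.injOn).subset fun t ht => ?_).countable
  have ht' : polyFun (linearForm v ^ n + Q) (ξ + t • a) = 0 := ht
  rw [heval] at ht'
  simpa [hne] using ht'

/-- On a line where the linear form is not constant, each integer value of the form is attained for
at most one parameter, so the exceptional set is countable. -/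
theorem ae_exp_linearForm_ne_one {v : Fin d → ℂ} (hv : v ≠ 0) :
    ∀ᵐ ξ : EuclideanSpace ℝ (Fin d),
      Complex.exp (-2 * Real.pi * Complex.I * polyFun (linearForm v) ξ) ≠ 1 := by
  obtain ⟨a, ha⟩ := exists_polyFun_linearForm_ne_zero hv
  have := continuous_polyFun (linearForm v)
  refine ae_of_countable_along_lines
    (s := {ξ | Complex.exp (-2 * Real.pi * Complex.I * polyFun (linearForm v) ξ) = 1})
    (isClosed_eq (by fun_prop) continuous_const) a fun ξ => ?_
  have hsub : {t : ℝ | ξ + t • a ∈ {ξ | Complex.exp (-2 * Real.pi * Complex.I *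
      polyFun (linearForm v) ξ) = 1}} ⊆ ⋃ n : ℤ, {t : ℝ |
        (polyFun (linearForm v) ξ + t * polyFun (linearForm v) a : ℂ) = -n} := by
    intro t ht
    have ht' : Complex.exp (-2 * Real.pi * Complex.I * polyFun (linearForm v) (ξ + t • a)) = 1 := ht
    rw [polyFun_linearForm_add_smul, Complex.exp_eq_one_iff] at ht'
    obtain ⟨n, hn⟩ := ht'
    refine Set.mem_iUnion.2 ⟨n, ?_⟩
    have h2 : (2 * Real.pi * Complex.I : ℂ) ≠ 0 := Complex.two_pi_I_ne_zero
    refine mul_left_cancel₀ h2 ?_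
    linear_combination -hn
  refine (Set.countable_iUnion fun n => ?_).mono hsub
  refine Set.Subsingleton.countable fun t ht t' ht' => ?_
  have h : ((t : ℂ) - t') * polyFun (linearForm v) a = 0 := by
    have h1 : (polyFun (linearForm v) ξ + t * polyFun (linearForm v) a : ℂ) = -n := ht
    have h2 : (polyFun (linearForm v) ξ + t' * polyFun (linearForm v) a : ℂ) = -n := ht'
    linear_combination h1 - h2
  rcases mul_eq_zero.1 h with h | h
  · exact_mod_cast sub_eq_zero.1 h
  · exact absurd h ha

theorem exists_of_ae_of_absolutelyContinuous (hac : μ ≪ volume) (h0 : μ ≠ 0)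
    {p : EuclideanSpace ℝ (Fin d) → Prop} (h : ∀ᵐ ξ, p ξ)
    (h' : ∀ᵐ ξ ∂μ, ¬ p ξ) : False := by
  have : NeZero μ := ⟨h0⟩
  obtain ⟨ξ, h1, h2⟩ := (Filter.Eventually.and (hac.ae_le h : ∀ᵐ ξ ∂μ, p ξ) h').exists
  exact h2 h1

/-- The quotient of two exponentials differs from `1` off a Lebesgue null set, and `μ` is nonzero
and absolutely continuous. -/
theorem expPoly_one_injective (hac : μ ≪ volume) (h0 : μ ≠ 0) :
    Function.Injective fun z => expPoly hμ z 1 := by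
  intro z w h
  by_contra hne
  refine exists_of_ae_of_absolutelyContinuous hac h0
    (ae_exp_linearForm_ne_one (sub_ne_zero.2 hne)) ?_
  have h' : expPoly hμ z 1 = expPoly hμ w 1 := h
  filter_upwards [coeFn_expPoly hμ z 1, coeFn_expPoly hμ w 1] with ξ h1 h2
  rw [h', h2, expMul_eq, expMul_eq, polyFun_one, mul_one, mul_one] at h1
  have : polyFun (linearForm (z - w)) ξ =
      polyFun (linearForm z) ξ - polyFun (linearForm w) ξ := by
    simp [polyFun_linearForm, sub_mul, Finset.sum_sub_distrib]
  rw [this, mul_sub, Complex.exp_sub, h1, not_not]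
  exact div_self (Complex.exp_ne_zero _)

/-- A polynomial with leading part a power of a nonzero linear form is nonzero in `L²(μ)`. -/
theorem expPoly_linearForm_pow_add_ne_zero (hac : μ ≪ volume) (h0 : μ ≠ 0) (z : Fin d → ℂ)
    {v : Fin d → ℂ} (hv : v ≠ 0) {n : ℕ} {Q : MvPolynomial (Fin d) ℂ} (hQ : Q.totalDegree < n) :
    expPoly hμ z (linearForm v ^ n + Q) ≠ 0 := by
  intro h
  refine exists_of_ae_of_absolutelyContinuous hac h0
    (ae_polyFun_linearForm_pow_add_ne_zero hv hQ) ?_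
  have := Lp.coeFn_zero ℂ 2 μ
  rw [← h] at this
  filter_upwards [coeFn_expPoly hμ z (linearForm v ^ n + Q), this] with ξ h1 h2
  rw [h2, expMul_eq] at h1
  rw [not_not]
  exact (mul_eq_zero.1 h1.symm).resolve_left (Complex.exp_ne_zero _)

theorem expPoly_one_ne_zero (h0 : μ ≠ 0) (z : Fin d → ℂ) : expPoly hμ z 1 ≠ 0 := by
  intro h
  have : NeZero μ := ⟨h0⟩
  have h1 := Lp.coeFn_zero ℂ 2 μ
  rw [← h] at h1
  obtain ⟨ξ, h2, h3⟩ := (h1.and (coeFn_expPoly hμ z 1)).exists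
  rw [h2, expMul_eq, polyFun_one, mul_one] at h3
  exact Complex.exp_ne_zero _ h3.symm

theorem fderiv_expPoly_one_injective (hac : μ ≪ volume) (h0 : μ ≠ 0) (z : Fin d → ℂ) :
    Function.Injective (fderiv ℂ (fun z => expPoly hμ z 1) z) := by
  refine (injective_iff_map_eq_zero _).2 fun v hv => ?_
  by_contra hne
  rw [fderiv_expPoly_one_apply, smul_eq_zero_iff_right (by simp)] at hv
  refine expPoly_linearForm_pow_add_ne_zero hμ hac h0 z hne (n := 1) (Q := 0) (by simp) ?_
  simpa using hv

/-- The exponentials with real frequencies tend weakly to zero at infinity. -/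
theorem tendsto_inner_expPoly_cocompact [IsFiniteMeasure μ] (hac : μ ≪ volume)
    (x : EuclideanSpace ℝ (Fin d)) :
    Tendsto (fun y => inner ℂ (expPoly hμ (complexify x) 1) (expPoly hμ (complexify y) 1))
      (cocompact _) (𝓝 0) := by
  -- Riemann–Lebesgue: as a function of `y`, the inner product is the Fourier integral of the
  -- density of `μ` times the conjugate of `e_x`.
  refine (tendsto_integral_exp_inner_smul_cocompact (fun ξ : EuclideanSpace ℝ (Fin d) =>
    (μ.rnDeriv volume ξ).toReal • star (expMul (complexify x) (polyFun 1) ξ))).congr fun y => ?_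
  rw [inner_expPoly, ← integral_rnDeriv_smul hac]
  congr 1
  ext ξ
  rw [smul_comm, expMul_eq (complexify y), polyFun_linearForm, polyFun_one, mul_one]
  congr 1
  rw [Circle.smul_def, smul_eq_mul, Real.fourierChar_apply]
  congr 2
  simp [complexify, PiLp.inner_apply, Finset.mul_sum]
  rw [Finset.sum_mul]
  exact Finset.sum_congr rfl fun i _ => by ring

/-- Along an ultrafilter, `g` either stays in a compact set, where injectivity identifies its limit,
or escapes to infinity. In the second case the exponentials tend weakly to zero, against their
convergence to `e_x ≠ 0`. -/
theorem tendsto_of_tendsto_expPoly [IsFiniteMeasure μ] (hac : μ ≪ volume) (h0 : μ ≠ 0)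
    {α : Type*} {l : Filter α} {g : α → EuclideanSpace ℝ (Fin d)} {x : EuclideanSpace ℝ (Fin d)}
    (h : Tendsto (fun a => expPoly hμ (complexify (g a)) 1) l (𝓝 (expPoly hμ (complexify x) 1))) :
    Tendsto g l (𝓝 x) := by
  have hcont : Continuous fun y : EuclideanSpace ℝ (Fin d) => expPoly hμ (complexify y) 1 :=
    (continuous_expPoly hμ 1).comp (by unfold complexify; fun_prop)
  rw [tendsto_iff_ultrafilter]
  intro 𝒰 h𝒰
  have h𝒰' := h.mono_left h𝒰
  by_cases hK : ∃ K : Set (EuclideanSpace ℝ (Fin d)), IsCompact K ∧ K ∈ 𝒰.map g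
  · obtain ⟨K, hKc, hK⟩ := hK
    obtain ⟨y, -, hy⟩ := hKc.ultrafilter_le_nhds (𝒰.map g) (by simpa using hK)
    have hy' : Tendsto g 𝒰 (𝓝 y) := hy
    have := tendsto_nhds_unique h𝒰' ((hcont.tendsto y).comp hy')
    have hxy := expPoly_one_injective hμ hac h0 this
    have : x = y := by
      ext i
      exact Complex.ofReal_injective (congrFun hxy i)
    rwa [this]
  · exfalso
    have hco : Tendsto g 𝒰 (cocompact _) := by
      refine (hasBasis_cocompact.tendsto_right_iff).2 fun K hKc => ?_
      by_contra hcon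
      refine hK ⟨K, hKc, ?_⟩
      have := Ultrafilter.eventually_not.2 hcon
      exact this.mono fun a ha => not_not.1 ha
    have h1 := (tendsto_inner_expPoly_cocompact hμ hac x).comp hco
    have h2 := (tendsto_const_nhds (x := expPoly hμ (complexify x) 1) (f := (𝒰 : Filter α))).inner
      (𝕜 := ℂ) h𝒰'
    have h3 := tendsto_nhds_unique h1 h2
    exact expPoly_one_ne_zero hμ h0 _ (inner_self_eq_zero.1 h3.symm)

end ExponentialFamily

/-! ### Lifting holomorphic maps through an immersion, and Liouville's theorem. -/

section HolomorphicLift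

variable {V H : Type*} [NormedAddCommGroup V] [NormedSpace ℂ V]
  [NormedAddCommGroup H] [NormedSpace ℂ H]

/-- Two holomorphic functions on a convex open set which agree near one point are equal. -/
theorem eqOn_of_convex_of_eventuallyEq [CompleteSpace H] {f g : V → H} {s : Set V}
    (hs : IsOpen s) (hc : Convex ℝ s) (hf : DifferentiableOn ℂ f s) (hg : DifferentiableOn ℂ g s)
    {q : V} (hq : q ∈ s) (h : f =ᶠ[𝓝 q] g) : Set.EqOn f g s := by
  intro z hz
  -- The complex line through `q` and `z` meets the convex set `s` in a convex set of parameters, so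
  -- the one-variable identity theorem applies.
  let γ : ℂ → V := fun t => q + t • (z - q)
  have hγ : Differentiable ℂ γ := by unfold γ; fun_prop
  have hγ0 : γ 0 = q := by simp [γ]
  have hγ1 : γ 1 = z := by simp [γ]
  have ho : IsOpen (γ ⁻¹' s) := hs.preimage hγ.continuous
  have hpre : IsPreconnected (γ ⁻¹' s) := by
    have : Convex ℝ (γ ⁻¹' s) := by
      intro a ha b hb m n hm hn hmn
      have : γ (m • a + n • b) = m • γ a + n • γ b := by
        have hq : q = m • q + n • q := by rw [← add_smul, hmn, one_smul]
        simp only [γ, smul_add, add_smul, smul_assoc]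
        nth_rewrite 1 [hq]
        abel
      rw [Set.mem_preimage, this]
      exact hc ha hb hm hn hmn
    exact this.isPreconnected
  have hfa : AnalyticOnNhd ℂ (f ∘ γ) (γ ⁻¹' s) :=
    (hf.comp hγ.differentiableOn fun _ h => h).analyticOnNhd ho
  have hga : AnalyticOnNhd ℂ (g ∘ γ) (γ ⁻¹' s) :=
    (hg.comp hγ.differentiableOn fun _ h => h).analyticOnNhd ho
  have h0 : f ∘ γ =ᶠ[𝓝 0] g ∘ γ :=
    (hγ.continuous.tendsto' 0 q hγ0).eventually h
  have := hfa.eqOn_of_preconnected_of_eventuallyEq hga hpre (by simpa [hγ0] using hq) h0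
    (show (1 : ℂ) ∈ γ ⁻¹' s by simpa [hγ1] using hz)
  simpa [hγ1] using this

/-- A map `e` with an injective derivative at `w₀` has a holomorphic local left inverse, through
which every lift of `E` near `w₀` factors. -/
theorem exists_local_lift [CompleteSpace V] [FiniteDimensional ℂ V] {H : Type*}
    [NormedAddCommGroup H] [InnerProductSpace ℂ H] [CompleteSpace H] {e E : V → H}
    (he : ContDiff ℂ 1 e) (hE : Differentiable ℂ E) {w₀ z₀ : V}
    (hinj : Function.Injective (fderiv ℂ e w₀)) (h0 : e w₀ = E z₀) :
    ∃ F : V → V, (∀ᶠ z in 𝓝 z₀, DifferentiableAt ℂ F z) ∧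
      ∀ᶠ p in 𝓝 z₀ ×ˢ 𝓝 w₀, e p.2 = E p.1 → p.2 = F p.1 := by
  -- The range of the derivative is finite-dimensional, so orthogonal projection onto it gives a
  -- continuous left inverse `Λ`. Then `Λ ∘ e` maps `V` to itself with derivative the identity, and
  -- the inverse function theorem applies to it.
  obtain ⟨Λ, hΛ⟩ : ∃ Λ : H →L[ℂ] V, Λ.comp (fderiv ℂ e w₀) = ContinuousLinearMap.id ℂ V := by
    let R := LinearMap.range (fderiv ℂ e w₀ : V →ₗ[ℂ] H)
    have : FiniteDimensional ℂ R := inferInstance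
    let eq := LinearEquiv.ofInjective (fderiv ℂ e w₀ : V →ₗ[ℂ] H) hinj
    refine ⟨(LinearMap.toContinuousLinearMap (eq.symm : R →ₗ[ℂ] V)).comp
      R.orthogonalProjectionOnto, ?_⟩
    ext v
    have : (fderiv ℂ e w₀) v = (eq v : H) := rfl
    simp only [ContinuousLinearMap.comp_apply, this,
      Submodule.orthogonalProjectionOnto_mem_subspace_eq_self]
    simp
  have hG : ContDiffAt ℂ 1 (fun w => Λ (e w)) w₀ := (Λ.contDiff.comp he).contDiffAt
  have hG' : HasFDerivAt (fun w => Λ (e w))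
      ((ContinuousLinearEquiv.refl ℂ V : V ≃L[ℂ] V) : V →L[ℂ] V) w₀ := by
    have := Λ.hasFDerivAt.comp w₀ (he.differentiable one_ne_zero w₀).hasFDerivAt
    rw [hΛ] at this
    exact this
  let g := hG.localInverse hG' one_ne_zero
  have hg : ContDiffAt ℂ 1 g (Λ (e w₀)) := hG.to_localInverse hG' one_ne_zero
  have hcont : Tendsto (fun z => Λ (E z)) (𝓝 z₀) (𝓝 (Λ (e w₀))) := by
    rw [h0]
    exact (Λ.continuous.comp hE.continuous).tendsto z₀
  refine ⟨fun z => g (Λ (E z)), ?_, ?_⟩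
  · have : ∀ᶠ x in 𝓝 (Λ (e w₀)), DifferentiableAt ℂ g x :=
      (hg.eventually (by simp)).mono fun x hx => hx.differentiableAt one_ne_zero
    filter_upwards [hcont.eventually this] with z hz
    exact hz.comp z (Λ.differentiableAt.comp z (hE z))
  · have hs := hG.hasStrictFDerivAt' hG' one_ne_zero
    have : ∀ᶠ w in 𝓝 w₀, g (Λ (e w)) = w := hs.eventually_left_inverse
    filter_upwards [this.prod_inr (𝓝 z₀)] with p hp hep
    rw [← hep, hp]

/-- Let `e` be an injective holomorphic immersion and `E` an entire map which lifts through `e`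
near a point. If all lifts satisfy a uniform bound on the derivative, then `E` has a lift which is
entire. -/
theorem exists_differentiable_lift [CompleteSpace V] [FiniteDimensional ℂ V] {H : Type*}
    [NormedAddCommGroup H] [InnerProductSpace ℂ H] [CompleteSpace H] {e E : V → H}
    (he : ContDiff ℂ 1 e) (hE : Differentiable ℂ E)
    (hinj : Function.Injective e) (himm : ∀ w, Function.Injective (fderiv ℂ e w))
    {p : V} {f₀ : V → V}
    (hf₀ : ∀ᶠ z in 𝓝 p, DifferentiableAt ℂ f₀ z ∧ E z = e (f₀ z)) {M : ℝ}
    (hM : ∀ (f : V → V) (z : V), (∀ᶠ z' in 𝓝 z, DifferentiableAt ℂ f z' ∧ E z' = e (f z')) →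
      ‖fderiv ℂ f z‖ ≤ M) :
    ∃ f : V → V, Differentiable ℂ f ∧ ∀ z, E z = e (f z) := by
  have hM0 : 0 ≤ M := (norm_nonneg _).trans (hM f₀ p hf₀)
  -- As `e` is injective, every lift agrees with `F` wherever it exists; off the preimage of the
  -- range of `e`, `F` has an irrelevant default value. `D` is the open set of points near which `F`
  -- is a holomorphic lift.
  let F : V → V := fun z => Function.invFun e (E z)
  have hF : ∀ {z w}, E z = e w → F z = w := fun {z w} h => by
    simp only [F, h]; exact Function.leftInverse_invFun hinj w
  let D : Set V := {z | ∀ᶠ z' in 𝓝 z, DifferentiableAt ℂ F z' ∧ E z' = e (F z')}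
  have hDopen : IsOpen D := isOpen_setOfPred_eventually_nhds
  have hD_of : ∀ {f : V → V} {z : V},
      (∀ᶠ z' in 𝓝 z, DifferentiableAt ℂ f z' ∧ E z' = e (f z')) → z ∈ D := by
    intro f z h
    filter_upwards [h.eventually_nhds] with z' hz'
    have : F =ᶠ[𝓝 z'] f := hz'.mono fun x hx => hF hx.2
    refine ⟨hz'.self_of_nhds.1.congr_of_eventuallyEq this, ?_⟩
    rw [this.self_of_nhds]
    exact hz'.self_of_nhds.2
  suffices hall : ∀ z, z ∈ D from
    ⟨F, fun z => (hall z).self_of_nhds.1, fun z => (hall z).self_of_nhds.2⟩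
  by_contra! hcon
  obtain ⟨z₁, hz₁⟩ := hcon
  let γ : ℝ → V := fun t => p + t • (z₁ - p)
  have hγ : Continuous γ := by unfold γ; fun_prop
  let B : Set ℝ := Set.Icc 0 1 ∩ γ ⁻¹' Dᶜ
  have hBc : IsCompact B := isCompact_Icc.inter_right (hDopen.isClosed_compl.preimage hγ)
  have hBne : B.Nonempty := ⟨1, ⟨zero_le_one, le_rfl⟩, by simpa [γ] using hz₁⟩
  -- `τ` is the first parameter at which the segment from `p` to `z₁` leaves `D`.
  obtain ⟨τ, ⟨hτ, hτD⟩, hτmin⟩ := hBc.exists_isLeast hBne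
  have hbefore : ∀ t ∈ Set.Ico 0 τ, γ t ∈ D := by
    intro t ht
    by_contra h
    exact absurd (hτmin ⟨⟨ht.1, ht.2.le.trans hτ.2⟩, h⟩) (not_le.2 ht.2)
  have hτpos : 0 < τ := by
    refine lt_of_le_of_ne hτ.1 fun h => hτD ?_
    rw [← h]
    simpa [γ] using hD_of hf₀
  -- The bound `M` makes the lift Lipschitz on `[0, τ)`, so that it has a limit `L τ`, over which
  -- the immersion can be inverted again.
  obtain ⟨L, hLlip, hL⟩ : ∃ L : ℝ → V, Continuous L ∧ Set.EqOn (F ∘ γ) L (Set.Ico 0 τ) := by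
    have hlip : LipschitzOnWith (M * ‖z₁ - p‖).toNNReal (F ∘ γ) (Set.Ico 0 τ) := by
      refine (convex_Ico 0 τ).lipschitzOnWith_of_nnnorm_hasDerivWithin_le
        (f' := fun t => fderiv ℂ F (γ t) (z₁ - p)) (fun t ht => ?_) fun t ht => ?_
      · have h1 : HasFDerivAt F ((fderiv ℂ F (γ t)).restrictScalars ℝ) (γ t) :=
          (hbefore t ht).self_of_nhds.1.hasFDerivAt.restrictScalars ℝ
        have h2 : HasDerivAt γ (z₁ - p) t := by
          have := ((hasDerivAt_id t).smul_const (z₁ - p)).const_add p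
          rw [one_smul] at this
          exact this
        exact (h1.comp_hasDerivAt t h2).hasDerivWithinAt
      · rw [← NNReal.coe_le_coe, coe_nnnorm, Real.coe_toNNReal _ (by positivity)]
        exact ((fderiv ℂ F (γ t)).le_opNorm _).trans (by gcongr; exact hM F _ (hbefore t ht))
    have : FiniteDimensional ℝ V := FiniteDimensional.complexToReal V
    obtain ⟨L, hL1, hL2⟩ := hlip.extend_finite_dimension
    exact ⟨L, hL1.continuous, hL2⟩
  have hτcl : τ ∈ closure (Set.Ico 0 τ) := by
    rw [closure_Ico hτpos.ne]; exact ⟨hτpos.le, le_rfl⟩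
  have hlift : e (L τ) = E (γ τ) := by
    have : Set.EqOn (fun t => e (L t)) (fun t => E (γ t)) (closure (Set.Ico 0 τ)) := by
      refine Set.EqOn.closure (fun t ht => ?_) (he.continuous.comp hLlip) (hE.continuous.comp hγ)
      rw [← hL ht]
      exact (hbefore t ht).self_of_nhds.2.symm
    exact this hτcl
  obtain ⟨G, hG, hGu⟩ := exists_local_lift he hE (himm (L τ)) hlift
  obtain ⟨r, hr, hball⟩ := Metric.eventually_nhds_iff_ball.1 hG
  have hGd : DifferentiableOn ℂ G (Metric.ball (γ τ) r) := fun z hz =>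
    (hball z hz).differentiableWithinAt
  -- Slightly before `τ`, the old lift is close enough to `L τ` to coincide with the new local lift
  -- `G`. The identity theorem spreads `E = e ∘ G` from there to the whole ball, which contains `γ
  -- τ`.
  obtain ⟨t, ht, htb, htu⟩ : ∃ t ∈ Set.Ico 0 τ, γ t ∈ Metric.ball (γ τ) r ∧
      ∀ᶠ q in 𝓝 (γ t) ×ˢ 𝓝 (F (γ t)), e q.2 = E q.1 → q.2 = G q.1 := by
    have h1 : ∀ᶠ t in 𝓝 τ, γ t ∈ Metric.ball (γ τ) r :=
      hγ.continuousAt.eventually (Metric.ball_mem_nhds _ hr)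
    have h2 : ∀ᶠ t in 𝓝 τ, ∀ᶠ q in 𝓝 (γ t) ×ˢ 𝓝 (L t), e q.2 = E q.1 → q.2 = G q.1 := by
      simp only [← nhds_prod_eq] at hGu ⊢
      exact (hγ.prodMk hLlip).continuousAt.eventually hGu.eventually_nhds
    have h3 : ∃ᶠ t in 𝓝 τ, t ∈ Set.Ico 0 τ := mem_closure_iff_frequently.1 hτcl
    obtain ⟨t, ht, h1, h2⟩ := (h3.and_eventually (h1.and h2)).exists
    refine ⟨t, ht, h1, ?_⟩
    have : F (γ t) = L t := hL ht
    rwa [this]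
  have hFt := hbefore t ht
  have hFG : E =ᶠ[𝓝 (γ t)] fun z => e (G z) := by
    have hFc : ContinuousAt F (γ t) := hFt.self_of_nhds.1.continuousAt
    filter_upwards [((tendsto_id (x := 𝓝 (γ t))).prodMk hFc).eventually htu, hFt] with z hz hz'
    rw [show G z = F z from (hz hz'.2.symm).symm]
    exact hz'.2
  have hEG := eqOn_of_convex_of_eventuallyEq Metric.isOpen_ball (convex_ball (γ τ) r)
    hE.differentiableOn ((he.differentiable one_ne_zero).comp_differentiableOn hGd) htb hFG
  refine hτD (hD_of (f := G) ?_)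
  filter_upwards [Metric.ball_mem_nhds (γ τ) hr] with z hz
  exact ⟨hball z hz, hEG hz⟩

/-- An entire map with bounded derivative is affine. -/
theorem eq_add_fderiv_of_bounded_fderiv {f : V → V} (hf : Differentiable ℂ f) [CompleteSpace V]
    {M : ℝ} (hM : ∀ z, ‖fderiv ℂ f z‖ ≤ M) (z : V) : f z = f 0 + fderiv ℂ f 0 z := by
  let φ : ℂ → V := fun t => f (t • z)
  have hder : ∀ t, HasDerivAt φ (fderiv ℂ f (t • z) z) t := fun t => by
    have h2 : HasDerivAt (fun t : ℂ => t • z) z t := by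
      simpa using (hasDerivAt_id t).smul_const z
    exact (hf (t • z)).hasFDerivAt.comp_hasDerivAt t h2
  have hφ : Differentiable ℂ φ := fun t => (hder t).differentiableAt
  have hd : Differentiable ℂ (deriv φ) := by
    have := hφ.contDiff (n := 2)
    exact ((contDiff_succ_iff_deriv (n := 1)).1 this).2.2.differentiable one_ne_zero
  -- Liouville's theorem is applied to the derivative of `f` along the complex line through `0` and
  -- `z`.
  have hb : Bornology.IsBounded (Set.range (deriv φ)) := by
    refine isBounded_iff_forall_norm_le.2 ⟨M * ‖z‖, ?_⟩
    rintro _ ⟨t, rfl⟩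
    rw [(hder t).deriv]
    exact ((fderiv ℂ f _).le_opNorm z).trans (by gcongr; exact hM _)
  have hconst : ∀ t, deriv φ t = fderiv ℂ f 0 z := fun t => by
    rw [hd.apply_eq_apply_of_bounded hb t 0, (hder 0).deriv, zero_smul]
  have : ∀ t, HasDerivAt (fun t : ℂ => φ t - t • fderiv ℂ f 0 z) 0 t := fun t => by
    have h1 : HasDerivAt φ (fderiv ℂ f 0 z) t := by rw [← hconst t]; exact (hφ t).hasDerivAt
    have h2 := h1.sub ((hasDerivAt_id t).smul_const (fderiv ℂ f 0 z))
    rw [one_smul, sub_self] at h2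
    exact h2
  have h10 := is_const_of_deriv_eq_zero (fun t => (this t).differentiableAt)
    (fun t => (this t).deriv) 1 0
  simp only [φ, one_smul, zero_smul, sub_zero] at h10
  rw [← h10]
  abel

end HolomorphicLift

/-! ### Real points of `ℂ^d` as a set of uniqueness. -/

theorem continuous_complexify {d : ℕ} : Continuous (complexify (d := d)) := by
  unfold complexify
  fun_prop

theorem complexify_injective {d : ℕ} : Function.Injective (complexify (d := d)) := fun x y h => by
  ext i
  exact Complex.ofReal_injective (congrFun h i)

theorem complexify_add {d : ℕ} (x y : EuclideanSpace ℝ (Fin d)) :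
    complexify (x + y) = complexify x + complexify y := by
  ext i; simp [complexify]

theorem complexify_smul {d : ℕ} (t : ℝ) (x : EuclideanSpace ℝ (Fin d)) :
    complexify (t • x) = (t : ℂ) • complexify x := by
  ext i; simp [complexify]

/-- Holomorphic maps which agree at the real points near a real point agree near this point. -/
theorem eventuallyEq_of_eventuallyEq_complexify {d : ℕ} {H : Type*} [NormedAddCommGroup H]
    [NormedSpace ℂ H] [CompleteSpace H] {f g : (Fin d → ℂ) → H} {p : EuclideanSpace ℝ (Fin d)}
    (hf : ∀ᶠ z in 𝓝 (complexify p), DifferentiableAt ℂ f z)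
    (hg : ∀ᶠ z in 𝓝 (complexify p), DifferentiableAt ℂ g z)
    (h : ∀ᶠ x in 𝓝 p, f (complexify x) = g (complexify x)) :
    f =ᶠ[𝓝 (complexify p)] g := by
  obtain ⟨r, hr, hball⟩ := Metric.eventually_nhds_iff_ball.1 (hf.and hg)
  let re : (Fin d → ℂ) → EuclideanSpace ℝ (Fin d) := fun z => WithLp.toLp 2 fun i => (z i).re
  let im : (Fin d → ℂ) → EuclideanSpace ℝ (Fin d) := fun z => WithLp.toLp 2 fun i => (z i).im
  have hre : Continuous re := (PiLp.continuous_toLp 2 _).comp (by fun_prop)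
  have hre0 : re (complexify p) = p := by ext i; simp [re, complexify]
  have hdecomp : ∀ z, z = complexify (re z) + Complex.I • complexify (im z) := fun z => by
    ext i
    simp only [complexify, re, im, Pi.add_apply, Pi.smul_apply, smul_eq_mul]
    rw [mul_comm]
    exact (Complex.re_add_im (z i)).symm
  have h1 : ∀ᶠ z in 𝓝 (complexify p), ∀ᶠ x in 𝓝 (re z), f (complexify x) = g (complexify x) :=
    (hre.tendsto' _ _ hre0).eventually h.eventually_nhds
  have h2 : ∀ᶠ z in 𝓝 (complexify p), ‖z - complexify p‖ < r / 3 := by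
    have := Metric.ball_mem_nhds (complexify p) (show 0 < r / 3 by positivity)
    filter_upwards [this] with z hz
    rwa [← dist_eq_norm]
  filter_upwards [h1, h2] with z hz hzr
  -- This line is real for real `t` and passes through `z` at `t = i`. For `‖t‖ < 2` its distance to
  -- the centre is at most `3 ‖z - p‖`, whence the radius `r / 3`.
  let γ : ℂ → Fin d → ℂ := fun t => complexify (re z) + t • complexify (im z)
  have hγ : Differentiable ℂ γ := by unfold γ; fun_prop
  have hγball : Set.MapsTo γ (Metric.ball 0 2) (Metric.ball (complexify p) r) := by
    intro t ht
    have ht' : ‖t‖ ≤ 2 := by simpa using (mem_ball_zero_iff.1 ht).le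
    have ha : ‖complexify (re z) - complexify p‖ ≤ ‖z - complexify p‖ := by
      refine (pi_norm_le_iff_of_nonneg (norm_nonneg _)).2 fun i => ?_
      refine le_trans ?_ (norm_le_pi_norm (z - complexify p) i)
      have : (complexify (re z) - complexify p) i = (((z - complexify p) i).re : ℂ) := by
        simp [complexify, re]
      rw [this, Complex.norm_real]
      exact Complex.abs_re_le_norm _
    have hb : ‖complexify (im z)‖ ≤ ‖z - complexify p‖ := by
      refine (pi_norm_le_iff_of_nonneg (norm_nonneg _)).2 fun i => ?_
      refine le_trans ?_ (norm_le_pi_norm (z - complexify p) i)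
      have : complexify (im z) i = (((z - complexify p) i).im : ℂ) := by
        simp [complexify, im]
      rw [this, Complex.norm_real]
      exact Complex.abs_im_le_norm _
    rw [mem_ball_iff_norm]
    calc ‖γ t - complexify p‖ = ‖(complexify (re z) - complexify p) + t • complexify (im z)‖ := by
          simp only [γ]; congr 1; abel
      _ ≤ ‖complexify (re z) - complexify p‖ + ‖t‖ * ‖complexify (im z)‖ := by
          rw [← norm_smul]; exact norm_add_le _ _
      _ ≤ ‖z - complexify p‖ + 2 * ‖z - complexify p‖ := by gcongr
      _ < r := by linarith
  have hfa : AnalyticOnNhd ℂ (f ∘ γ) (Metric.ball 0 2) := DifferentiableOn.analyticOnNhd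
    (fun t ht => ((hball _ (hγball ht)).1.comp t (hγ t)).differentiableWithinAt) Metric.isOpen_ball
  have hga : AnalyticOnNhd ℂ (g ∘ γ) (Metric.ball 0 2) := DifferentiableOn.analyticOnNhd
    (fun t ht => ((hball _ (hγball ht)).2.comp t (hγ t)).differentiableWithinAt) Metric.isOpen_ball
  have hreal : ∀ᶠ t : ℝ in 𝓝 0, (f ∘ γ) (t : ℂ) = (g ∘ γ) (t : ℂ) := by
    have hc : Tendsto (fun t : ℝ => re z + t • im z) (𝓝 0) (𝓝 (re z)) :=
      Continuous.tendsto' (by fun_prop) _ _ (by simp)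
    filter_upwards [hc.eventually hz] with t ht
    rwa [complexify_add, complexify_smul] at ht
  have hfreq : ∃ᶠ t in 𝓝[≠] (0 : ℂ), (f ∘ γ) t = (g ∘ γ) t := by
    have hten : Tendsto (fun t : ℝ => (t : ℂ)) (𝓝[≠] 0) (𝓝[≠] 0) := by
      refine tendsto_nhdsWithin_of_tendsto_nhds_of_eventually_within _ ?_ ?_
      · exact (Complex.continuous_ofReal.tendsto' 0 0 (by simp)).mono_left nhdsWithin_le_nhds
      · filter_upwards [self_mem_nhdsWithin] with t ht
        simpa using ht
    exact hten.frequently (hreal.filter_mono nhdsWithin_le_nhds).frequently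
  have := hfa.eqOn_of_preconnected_of_frequently_eq hga (convex_ball 0 2).isPreconnected
    (Metric.mem_ball_self two_pos) hfreq (show Complex.I ∈ Metric.ball (0 : ℂ) 2 by simp)
  simpa [γ, ← hdecomp] using this

/-! ### Action on jets and the eigenvalue bound. -/

section Jets

variable {d : ℕ} {μ : Measure (EuclideanSpace ℝ (Fin d))} (hμ : HasExpMoments μ)

/-- The span of the powers of order less than `n` of linear forms. -/
noncomputable def lowerPowers (d n : ℕ) : Submodule ℂ (MvPolynomial (Fin d) ℂ) :=
  Submodule.span ℂ {P | ∃ k < n, ∃ v : Fin d → ℂ, P = linearForm v ^ k}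

theorem totalDegree_le_of_mem_lowerPowers {n : ℕ} {P : MvPolynomial (Fin d) ℂ}
    (hP : P ∈ lowerPowers d n) : P.totalDegree ≤ n - 1 := by
  have : lowerPowers d n ≤ MvPolynomial.restrictTotalDegree (Fin d) ℂ (n - 1) := by
    refine Submodule.span_le.2 ?_
    rintro _ ⟨k, hk, v, rfl⟩
    exact (MvPolynomial.mem_restrictTotalDegree _ _ _).2
      ((totalDegree_linearForm_pow_le v k).trans (by omega))
  exact (MvPolynomial.mem_restrictTotalDegree _ _ _).1 (this hP)

instance (n : ℕ) : FiniteDimensional ℂ (lowerPowers d n) := by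
  have : lowerPowers d n ≤ MvPolynomial.restrictTotalDegree (Fin d) ℂ (n - 1) := fun P hP =>
    (MvPolynomial.mem_restrictTotalDegree _ _ _).2 (totalDegree_le_of_mem_lowerPowers hP)
  exact Submodule.finiteDimensional_of_le this

/-- This permits comparing two Taylor expansions coefficient by coefficient. The top term is itself
`o` of the previous power, so induction removes the lower coefficients first. -/
theorem eq_zero_of_sum_pow_smul_isLittleO {H : Type*} [NormedAddCommGroup H] [NormedSpace ℂ H]
    (a : ℕ → H) (n : ℕ)
    (h : (fun t : ℂ => ∑ k ∈ Finset.range (n + 1), t ^ k • a k) =o[𝓝[≠] 0] fun t => t ^ n) :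
    ∀ k ≤ n, a k = 0 := by
  have top : ∀ (m : ℕ) (b : H), (fun t : ℂ => t ^ m • b) =o[𝓝[≠] 0] (fun t => t ^ m) → b = 0 := by
    intro m b hb
    have h1 := hb.tendsto_inv_smul_nhds_zero
    have h2 : Tendsto (fun _ : ℂ => b) (𝓝[≠] 0) (𝓝 0) := by
      refine h1.congr' ?_
      filter_upwards [self_mem_nhdsWithin] with t ht
      rw [inv_smul_smul₀ (pow_ne_zero _ ht)]
    exact tendsto_nhds_unique tendsto_const_nhds h2
  induction n with
  | zero =>
    intro k hk
    obtain rfl : k = 0 := by omega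
    exact top 0 _ (by simpa using h)
  | succ n ih =>
    have hlt : (fun t : ℂ => t ^ (n + 1)) =o[𝓝[≠] 0] fun t => t ^ n :=
      (Asymptotics.isLittleO_pow_pow (Nat.lt_succ_self n)).mono nhdsWithin_le_nhds
    have hlow : ∀ k ≤ n, a k = 0 := by
      refine ih ?_
      have h1 : (fun t : ℂ => t ^ (n + 1) • a (n + 1)) =o[𝓝[≠] 0] fun t => t ^ n := by
        refine (Asymptotics.IsBigO.of_bound ‖a (n + 1)‖ (.of_forall fun t => ?_) :
          _ =O[𝓝[≠] (0 : ℂ)] fun t => t ^ (n + 1)).trans_isLittleO hlt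
        rw [norm_smul, mul_comm]
      refine ((h.trans hlt).sub h1).congr_left fun t => ?_
      rw [Finset.sum_range_succ, add_sub_cancel_right]
    intro k hk
    rcases Nat.lt_or_ge k (n + 1) with hk' | hk'
    · exact hlow k (by omega)
    · obtain rfl : k = n + 1 := by omega
      refine top (n + 1) _ (h.congr_left fun t => ?_)
      rw [Finset.sum_range_succ, Finset.sum_eq_zero, zero_add]
      intro j hj
      rw [hlow j (by simpa [Nat.lt_succ_iff] using hj), smul_zero]

/-- Expanding one factor in coordinates lowers the exponent. Continuity in `v` is needed to pass to
the limit of difference quotients in the leading term of a jet. -/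
theorem continuous_expPoly_linearForm_pow (z : Fin d → ℂ) (n : ℕ) (P : MvPolynomial (Fin d) ℂ) :
    Continuous fun v => expPoly hμ z (linearForm v ^ n * P) := by
  induction n generalizing P with
  | zero => simpa using continuous_const
  | succ n ih =>
    have : (fun v => expPoly hμ z (linearForm v ^ (n + 1) * P)) = fun v : Fin d → ℂ =>
        ∑ i, v i • expPoly hμ z (linearForm v ^ n * (MvPolynomial.X i * P)) := by
      ext1 v
      rw [pow_succ, mul_assoc]
      nth_rewrite 2 [linearForm]
      simp only [Finset.sum_mul, Finset.mul_sum, map_sum, ← map_smul]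
      refine Finset.sum_congr rfl fun i _ => ?_
      rw [MvPolynomial.smul_eq_C_mul]
      congr 1
      ring
    rw [this]
    exact continuous_finsetSum _ fun i _ => (continuous_apply i).smul (ih _)

/-- If `T` maps the exponentials with frequencies `z` to those with frequencies `f z`, then it maps
the jets at `z₀` to jets at `f z₀`, with leading part given by the derivative of `f`. -/
theorem jet_mem_map_lowerPowers {T : Lp ℂ 2 μ →L[ℂ] Lp ℂ 2 μ} {f : (Fin d → ℂ) → Fin d → ℂ}
    {z₀ : Fin d → ℂ} (hf : DifferentiableAt ℂ f z₀)
    (hT : ∀ᶠ z in 𝓝 z₀, T (expPoly hμ z 1) = expPoly hμ (f z) 1) (n : ℕ) (v : Fin d → ℂ) :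
    (∀ k < n, T (expPoly hμ z₀ (linearForm v ^ k)) ∈
      (lowerPowers d n).map (expPoly hμ (f z₀))) ∧
    T (expPoly hμ z₀ (linearForm v ^ n)) -
      expPoly hμ (f z₀) (linearForm (fderiv ℂ f z₀ v) ^ n) ∈
        (lowerPowers d n).map (expPoly hμ (f z₀)) := by
  set w := f z₀
  set K := (lowerPowers d n).map (expPoly hμ w)
  -- Applying `q` means working modulo `K`, which swallows all terms of order less than `n` in the
  -- expansion at `w`.
  let q : Lp ℂ 2 μ →L[ℂ] Lp ℂ 2 μ := ContinuousLinearMap.id ℂ _ - K.starProjection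
  have hq : ∀ x, q x = 0 ↔ x ∈ K := fun x => by
    rw [← Submodule.starProjection_eq_self_iff]
    exact ⟨fun h => (sub_eq_zero.1 h).symm, fun h => sub_eq_zero.2 h.symm⟩
  let c : ℕ → ℂ := fun k => (-2 * Real.pi * Complex.I) ^ k / k.factorial
  have hc : ∀ k, c k ≠ 0 := fun k => div_ne_zero (pow_ne_zero _ (by simp))
    (by exact_mod_cast k.factorial_ne_zero)
  have hlf : ∀ (t : ℂ) (u : Fin d → ℂ) (k : ℕ) (z : Fin d → ℂ),
      expPoly hμ z (linearForm (t • u) ^ k * 1) = t ^ k • expPoly hμ z (linearForm u ^ k) := by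
    intro t u k z
    rw [linearForm_smul, smul_pow, mul_one, map_smul]
  let γ : ℂ → Fin d → ℂ := fun t => z₀ + t • v
  have hγ : HasDerivAt γ v 0 := by
    have := ((hasDerivAt_id (0 : ℂ)).smul_const v).const_add z₀
    rwa [one_smul] at this
  have hγ0 : γ 0 = z₀ := by simp [γ]
  have hfγ : HasDerivAt (f ∘ γ) (fderiv ℂ f z₀ v) 0 := by
    refine HasFDerivAt.comp_hasDerivAt (0 : ℂ) ?_ hγ
    rw [hγ0]
    exact hf.hasFDerivAt
  -- Writing `f (γ t) - w = t • s t` extracts exactly `tⁿ` from the `n`-th term, and `s t` tends to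
  -- the derivative in direction `v`.
  let s : ℂ → Fin d → ℂ := fun t => t⁻¹ • (f (γ t) - w)
  have hs : Tendsto s (𝓝[≠] 0) (𝓝 (fderiv ℂ f z₀ v)) := by
    have := hfγ.tendsto_slope
    refine this.congr fun t => ?_
    simp [s, slope, hγ0, w]
  have hlit : (fun t : ℂ => t ^ (n + 1)) =o[𝓝[≠] 0] fun t => t ^ n :=
    (Asymptotics.isLittleO_pow_pow (Nat.lt_succ_self n)).mono nhdsWithin_le_nhds
  -- Taylor expansion at `z₀`
  have h1 : (fun t : ℂ => q (T (expPoly hμ (γ t) 1)) - ∑ k ∈ Finset.range (n + 1),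
      t ^ k • (c k • q (T (expPoly hμ z₀ (linearForm v ^ k))))) =o[𝓝[≠] 0] fun t => t ^ n := by
    obtain ⟨C, hC⟩ := exists_norm_expPoly_sub_sum_le hμ z₀ 1 (n + 1)
    have hb : (fun t : ℂ => expPoly hμ (γ t) 1 - ∑ k ∈ Finset.range (n + 1),
        c k • expPoly hμ z₀ (linearForm (t • v) ^ k * 1)) =O[𝓝[≠] 0] fun t => t ^ (n + 1) := by
      refine Asymptotics.IsBigO.of_bound (C * ‖v‖ ^ (n + 1)) ?_
      have ht : ∀ᶠ t : ℂ in 𝓝 0, ‖t • v‖ < 1 := by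
        have : Tendsto (fun t : ℂ => ‖t • v‖) (𝓝 0) (𝓝 0) :=
          Continuous.tendsto' (by fun_prop) _ _ (by simp)
        exact this.eventually (gt_mem_nhds one_pos)
      filter_upwards [ht.filter_mono nhdsWithin_le_nhds] with t ht
      refine (hC (t • v) ht.le).trans (le_of_eq ?_)
      rw [norm_smul, mul_pow, norm_pow]
      ring
    refine ((((q.comp T).isBigO_comp _ _).trans hb).trans_isLittleO hlit).congr_left fun t => ?_
    simp only [map_sub, map_sum, map_smul, hlf, ContinuousLinearMap.comp_apply]
    congr 1
    exact Finset.sum_congr rfl fun k _ => smul_comm _ _ _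
  -- Taylor expansion at `w`
  have h2 : (fun t : ℂ => q (expPoly hμ (f (γ t)) 1) -
      t ^ n • (c n • q (expPoly hμ w (linearForm (fderiv ℂ f z₀ v) ^ n)))) =o[𝓝[≠] 0]
        fun t => t ^ n := by
    obtain ⟨C, hC⟩ := exists_norm_expPoly_sub_sum_le hμ w 1 (n + 1)
    have hy0 : Tendsto (fun t => f (γ t) - w) (𝓝[≠] 0) (𝓝 0) := by
      have := hfγ.continuousAt.tendsto.sub_const w
      simp only [Function.comp_apply, hγ0] at this
      rw [show f z₀ - w = 0 from sub_self _] at this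
      exact this.mono_left nhdsWithin_le_nhds
    have hyO : (fun t => f (γ t) - w) =O[𝓝[≠] 0] fun t : ℂ => t := by
      have := hfγ.isBigO_sub
      simp only [Function.comp_apply, hγ0, sub_zero] at this
      exact this.mono nhdsWithin_le_nhds
    have hb : (fun t : ℂ => expPoly hμ (f (γ t)) 1 - ∑ k ∈ Finset.range (n + 1),
        c k • expPoly hμ w (linearForm (f (γ t) - w) ^ k * 1)) =O[𝓝[≠] 0]
          fun t => t ^ (n + 1) := by
      refine (Asymptotics.IsBigO.of_bound C ?_ :
        _ =O[𝓝[≠] (0 : ℂ)] fun t => ‖f (γ t) - w‖ ^ (n + 1)).trans (hyO.norm_left.pow (n + 1))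
      filter_upwards [hy0.norm.eventually (gt_mem_nhds (by simp : ‖(0 : Fin d → ℂ)‖ < 1))]
        with t ht
      have := hC _ ht.le
      rw [add_sub_cancel] at this
      rwa [norm_pow, norm_norm]
    have hb' := ((q.isBigO_comp _ _).trans hb).trans_isLittleO hlit
    have hm : (fun t : ℂ => t ^ n • (c n • (q (expPoly hμ w (linearForm (s t) ^ n)) -
        q (expPoly hμ w (linearForm (fderiv ℂ f z₀ v) ^ n))))) =o[𝓝[≠] 0] fun t => t ^ n := by
      have hcont : Continuous fun u : Fin d → ℂ => q (expPoly hμ w (linearForm u ^ n)) := by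
        have := q.continuous.comp (continuous_expPoly_linearForm_pow hμ w n 1)
        simp only [mul_one] at this
        exact this
      have hz : Tendsto (fun t => c n • (q (expPoly hμ w (linearForm (s t) ^ n)) -
          q (expPoly hμ w (linearForm (fderiv ℂ f z₀ v) ^ n)))) (𝓝[≠] 0) (𝓝 0) := by
        have := (((hcont.tendsto _).comp hs).sub_const
          (q (expPoly hμ w (linearForm (fderiv ℂ f z₀ v) ^ n)))).const_smul (c n)
        simpa using this
      have := (Asymptotics.isBigO_refl (fun t : ℂ => t ^ n) (𝓝[≠] 0)).smul_isLittleO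
        ((Asymptotics.isLittleO_one_iff ℂ).2 hz)
      simpa using this
    refine (hb'.add hm).congr' ?_ .rfl
    filter_upwards [self_mem_nhdsWithin] with t ht
    have hst : f (γ t) - w = t • s t := by rw [smul_inv_smul₀ ht]
    have hzero : ∀ k ∈ Finset.range n, q (c k • expPoly hμ w (linearForm (t • s t) ^ k * 1)) = 0 :=
      fun k hk => by
        rw [map_smul, hlf, map_smul,
          (hq _).2 ⟨_, Submodule.subset_span ⟨k, Finset.mem_range.1 hk, _, rfl⟩, rfl⟩,
          smul_zero, smul_zero]
    rw [map_sub, map_sum, Finset.sum_range_succ, hst, Finset.sum_eq_zero hzero, hlf, zero_add,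
      map_smul, map_smul, smul_comm (c n) (t ^ n), smul_sub, smul_sub]
    abel
  -- These are the coefficients of the difference of the two expansions of the same vector modulo
  -- `K`. The one at `w` contributes only to order `n`.
  let a : ℕ → Lp ℂ 2 μ := fun k => c k • q (T (expPoly hμ z₀ (linearForm v ^ k))) -
    if k = n then c n • q (expPoly hμ w (linearForm (fderiv ℂ f z₀ v) ^ n)) else 0
  have ha := eq_zero_of_sum_pow_smul_isLittleO a n (by
    refine (h2.sub h1).congr' ?_ .rfl
    have hev : ∀ᶠ t in 𝓝[≠] 0, T (expPoly hμ (γ t) 1) = expPoly hμ (f (γ t)) 1 :=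
      (hγ.continuousAt.tendsto.eventually (by rwa [hγ0])).filter_mono nhdsWithin_le_nhds
    filter_upwards [hev] with t ht
    rw [ht]
    simp only [a, smul_sub, Finset.sum_sub_distrib, smul_ite, smul_zero, Finset.sum_ite_eq',
      Finset.mem_range, Nat.lt_succ_self, if_true]
    abel)
  refine ⟨fun k hk => (hq _).1 ?_, (hq _).1 ?_⟩
  · have := ha k hk.le
    simp only [a, hk.ne, if_false, sub_zero] at this
    exact (smul_eq_zero_iff_right (hc k)).1 this
  · have := ha n le_rfl
    simp only [a, if_true, ← smul_sub, ← map_sub] at this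
    exact (smul_eq_zero_iff_right (hc n)).1 this

/-- `T` is triangular with respect to the order of jets. The lower space is spanned by powers in all
directions, each of which the jet lemma handles. -/
theorem exists_map_expPoly_linearForm_pow_add {T : Lp ℂ 2 μ →L[ℂ] Lp ℂ 2 μ}
    {f : (Fin d → ℂ) → Fin d → ℂ} {z₀ : Fin d → ℂ} (hf : DifferentiableAt ℂ f z₀)
    (hT : ∀ᶠ z in 𝓝 z₀, T (expPoly hμ z 1) = expPoly hμ (f z) 1) (n : ℕ) (v : Fin d → ℂ)
    {P : MvPolynomial (Fin d) ℂ} (hP : P ∈ lowerPowers d n) :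
    ∃ Q ∈ lowerPowers d n, T (expPoly hμ z₀ (linearForm v ^ n + P)) =
      expPoly hμ (f z₀) (linearForm (fderiv ℂ f z₀ v) ^ n + Q) := by
  have h1 : T (expPoly hμ z₀ P) ∈ (lowerPowers d n).map (expPoly hμ (f z₀)) := by
    induction hP using Submodule.span_induction with
    | mem P hP =>
      obtain ⟨k, hk, u, rfl⟩ := hP
      exact (jet_mem_map_lowerPowers hμ hf hT n u).1 k hk
    | zero => simp
    | add P Q _ _ hP hQ => rw [map_add, map_add]; exact add_mem hP hQ
    | smul c P _ hP => rw [map_smul, map_smul]; exact Submodule.smul_mem _ _ hP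
  obtain ⟨Q, hQ, hQe⟩ := add_mem h1 (jet_mem_map_lowerPowers hμ hf hT n v).2
  refine ⟨Q, hQ, ?_⟩
  rw [map_add, map_add, map_add, hQe]
  abel

/-- The substitution `P ↦ P ∘ Aᵀ`. -/
noncomputable def substTranspose (A : Matrix (Fin d) (Fin d) ℝ) :
    MvPolynomial (Fin d) ℂ →ₐ[ℂ] MvPolynomial (Fin d) ℂ :=
  MvPolynomial.aeval fun i => linearForm fun j => (A j i : ℂ)

theorem substTranspose_linearForm (A : Matrix (Fin d) (Fin d) ℝ) (v : Fin d → ℂ) :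
    substTranspose A (linearForm v) = linearForm ((A.map Complex.ofReal).mulVec v) := by
  simp only [substTranspose, linearForm, map_sum, map_mul, MvPolynomial.aeval_X,
    MvPolynomial.algHom_C, Matrix.mulVec, dotProduct, Matrix.map_apply, Finset.mul_sum,
    MvPolynomial.algebraMap_eq, Finset.sum_mul]
  rw [Finset.sum_comm]
  refine Finset.sum_congr rfl fun i _ => Finset.sum_congr rfl fun j _ => ?_
  ring

theorem substTranspose_mem_lowerPowers (A : Matrix (Fin d) (Fin d) ℝ) {n : ℕ}
    {P : MvPolynomial (Fin d) ℂ} (hP : P ∈ lowerPowers d n) :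
    substTranspose A P ∈ lowerPowers d n := by
  induction hP using Submodule.span_induction with
  | mem P hP =>
    obtain ⟨k, hk, v, rfl⟩ := hP
    rw [map_pow, substTranspose_linearForm]
    exact Submodule.subset_span ⟨k, hk, _, rfl⟩
  | zero => simp
  | add P Q _ _ hP hQ => rw [map_add]; exact add_mem hP hQ
  | smul c P _ hP => rw [map_smul]; exact Submodule.smul_mem _ _ hP

theorem polyFun_substTranspose (A : Matrix (Fin d) (Fin d) ℝ) (P : MvPolynomial (Fin d) ℂ)
    (ξ : EuclideanSpace ℝ (Fin d)) :
    polyFun (substTranspose A P) ξ = polyFun P (Matrix.toEuclideanLin A.transpose ξ) := by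
  induction P using MvPolynomial.induction_on with
  | C c => simp [polyFun, substTranspose]
  | add P Q hP hQ => rw [map_add, polyFun_add, polyFun_add, hP, hQ]
  | mul_X P i hP =>
    rw [map_mul, polyFun_mul, polyFun_mul, hP]
    congr 1
    rw [substTranspose, MvPolynomial.aeval_X, polyFun_linearForm]
    simp [polyFun, Matrix.toLpLin_apply, Matrix.mulVec, dotProduct]

theorem continuous_toEuclideanLin (A : Matrix (Fin d) (Fin d) ℝ) :
    Continuous (Matrix.toEuclideanLin A) :=
  LinearMap.continuous_of_finiteDimensional _

theorem expMul_zero (h : EuclideanSpace ℝ (Fin d) → ℂ) : expMul 0 h = h := by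
  ext ξ; simp [expMul]

/-- The factor does not depend on the degree of `P`, so it disappears when `n`-th roots are taken.
-/
theorem norm_expPoly_zero_substTranspose_le {A : Matrix (Fin d) (Fin d) ℝ} {c : ℝ≥0∞} (hc : c ≠ ∞)
    (hA : μ.map (Matrix.toEuclideanLin A.transpose) ≤ c • μ) (P : MvPolynomial (Fin d) ℂ) :
    ‖expPoly hμ 0 (substTranspose A P)‖ ≤ (c ^ (1 / 2 : ℝ)).toReal * ‖expPoly hμ 0 P‖ := by
  have hnorm : ∀ P, ‖expPoly hμ 0 P‖ = (eLpNorm (polyFun P) 2 μ).toReal := fun P => by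
    rw [expPoly, LinearMap.coe_mk, AddHom.coe_mk, Lp.norm_toLp, expMul_zero]
  rw [hnorm, hnorm, ← ENNReal.toReal_mul]
  have hfin : eLpNorm (polyFun P) 2 μ ≠ ∞ := by
    have := (hμ.memLp_expMul_polyFun 0 P).eLpNorm_ne_top
    rwa [expMul_zero] at this
  refine ENNReal.toReal_mono (ENNReal.mul_ne_top (ENNReal.rpow_ne_top_of_nonneg (by simp) hc) hfin)
    ?_
  have hcomp : polyFun (substTranspose A P) =
      polyFun P ∘ (Matrix.toEuclideanLin A.transpose) := funext (polyFun_substTranspose A P)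
  rw [hcomp, ← eLpNorm_map_measure (continuous_polyFun P).aestronglyMeasurable
    (continuous_toEuclideanLin _).aemeasurable]
  refine (eLpNorm_mono_measure _ hA).trans (le_of_eq ?_)
  rw [eLpNorm_smul_measure_of_ne_top (by simp)]
  simp

/-- The exponential growth condition for the multiplication operators on polynomials. -/
def ExpGrowthBound (hμ : HasExpMoments μ) (C : ℝ) : Prop :=
  ∀ z : Fin d → ℂ, ∀ᶠ n : ℕ in atTop, ∀ P : MvPolynomial (Fin d) ℂ, P.totalDegree ≤ n →
    ‖expPoly hμ z P‖ ≤ C ^ n * ‖expPoly hμ 0 P‖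

/-- The exponential at `w` times the conjugate of the one at `star w` equals `1`, so this is
Cauchy–Schwarz. It turns the upper bound of (B) at `star w` into a lower bound at `w`. -/
theorem norm_expPoly_zero_sq_le (w : Fin d → ℂ) (P : MvPolynomial (Fin d) ℂ) :
    ‖expPoly hμ 0 P‖ ^ 2 ≤ ‖expPoly hμ (star w) P‖ * ‖expPoly hμ w P‖ := by
  have h : inner ℂ (expPoly hμ 0 P) (expPoly hμ 0 P) =
      inner ℂ (expPoly hμ (star w) P) (expPoly hμ w P) := by
    rw [inner_expPoly, inner_expPoly]
    congr 1
    ext ξ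
    rw [expMul_zero, expMul_eq, expMul_eq]
    have : star (polyFun (linearForm (star w)) ξ) = polyFun (linearForm w) ξ := by
      simp [polyFun_linearForm, star_sum]
    have h2 : star (Complex.exp (-2 * Real.pi * Complex.I * polyFun (linearForm (star w)) ξ)) =
        (Complex.exp (-2 * Real.pi * Complex.I * polyFun (linearForm w) ξ))⁻¹ := by
      rw [← Complex.exp_neg, Complex.star_def, ← Complex.exp_conj, ← this]
      simp [Complex.conj_ofNat]
    rw [star_mul', h2]
    have := Complex.exp_ne_zero (-2 * Real.pi * Complex.I * polyFun (linearForm w) ξ)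
    field_simp
  have h2 : ‖inner ℂ (expPoly hμ 0 P) (expPoly hμ 0 P)‖ = ‖expPoly hμ 0 P‖ ^ 2 := by
    rw [inner_self_eq_norm_sq_to_K]; simp
  rw [← h2, h]
  exact norm_inner_le_norm _ _

/-- Let `δ` be the distance of `(vᵀξ)ⁿ` from the lower powers. Passing through `e_{z₀}`, `T`, the
removal of `e_{f(z₀)}` and the substitution by `A` leads back to a polynomial with leading part
`νⁿ(vᵀξ)ⁿ`, whose norm is at least `|ν|ⁿ δ`. The costs are `Cⁿ`, `‖T‖`, `Cⁿ` and `√c`; dividing by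
`δ > 0` and letting `n` grow leaves `C²`. -/
theorem norm_eigenvalue_le (hac : μ ≪ volume) (h0 : μ ≠ 0) {C : ℝ} (hC : 1 ≤ C)
    (hB : ExpGrowthBound hμ C) {T : Lp ℂ 2 μ →L[ℂ] Lp ℂ 2 μ} {f : (Fin d → ℂ) → Fin d → ℂ}
    {z₀ : Fin d → ℂ} (hf : DifferentiableAt ℂ f z₀)
    (hT : ∀ᶠ z in 𝓝 z₀, T (expPoly hμ z 1) = expPoly hμ (f z) 1)
    {A : Matrix (Fin d) (Fin d) ℝ} {c : ℝ≥0∞} (hc : c ≠ ∞)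
    (hA : μ.map (Matrix.toEuclideanLin A.transpose) ≤ c • μ) {v : Fin d → ℂ} (hv : v ≠ 0) {ν : ℂ}
    (hν : (A.map Complex.ofReal).mulVec (fderiv ℂ f z₀ v) = ν • v) : ‖ν‖ ≤ C ^ 2 := by
  have hC0 : 0 < C := one_pos.trans_le hC
  have key : ∀ᶠ n : ℕ in atTop, ‖ν‖ ^ n ≤ ((c ^ (1 / 2 : ℝ)).toReal * ‖T‖) * (C ^ 2) ^ n := by
    filter_upwards [hB z₀, hB (star (f z₀)), eventually_ge_atTop 1] with n hn1 hn2 hn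
    have hdeg : ∀ (u : Fin d → ℂ) {Q : MvPolynomial (Fin d) ℂ}, Q ∈ lowerPowers d n →
        (linearForm u ^ n + Q).totalDegree ≤ n := fun u Q hQ =>
      (MvPolynomial.totalDegree_add _ _).trans (max_le (totalDegree_linearForm_pow_le u n)
        ((totalDegree_le_of_mem_lowerPowers hQ).trans (by omega)))
    let K := (lowerPowers d n).map (expPoly hμ 0)
    -- The norm of `q x` is the distance of `x` from `K`. It is attained by some `Q` because `K` is
    -- finite-dimensional.
    let q : Lp ℂ 2 μ →L[ℂ] Lp ℂ 2 μ := Kᗮ.starProjection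
    have hqK : ∀ {Q}, Q ∈ lowerPowers d n → q (expPoly hμ 0 Q) = 0 := fun {Q} hQ =>
      (Submodule.starProjection_apply_eq_zero_iff _).2
        (K.le_orthogonal_orthogonal (Submodule.mem_map_of_mem hQ))
    have hqle : ∀ (u : Fin d → ℂ) {Q}, Q ∈ lowerPowers d n → ‖q (expPoly hμ 0 (linearForm u ^ n))‖ ≤
        ‖expPoly hμ 0 (linearForm u ^ n + Q)‖ := fun u Q hQ => by
      rw [← add_zero (q _), ← hqK hQ, ← map_add, ← map_add]
      exact Submodule.norm_starProjection_apply_le _ _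
    obtain ⟨Q, hQ, hQe⟩ : ∃ Q ∈ lowerPowers d n, expPoly hμ 0 (linearForm v ^ n + Q) =
        q (expPoly hμ 0 (linearForm v ^ n)) := by
      obtain ⟨Q, hQ, hQe⟩ : K.starProjection (expPoly hμ 0 (linearForm v ^ n)) ∈ K :=
        Submodule.starProjection_apply_mem _ _
      refine ⟨-Q, neg_mem hQ, ?_⟩
      rw [map_add, map_neg, hQe, ← sub_eq_add_neg, ← Submodule.starProjection_orthogonal_val]
    have hpos : 0 < ‖q (expPoly hμ 0 (linearForm v ^ n))‖ := by
      rw [← hQe, norm_pos_iff]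
      refine expPoly_linearForm_pow_add_ne_zero hμ hac h0 0 hv ?_
      have := totalDegree_le_of_mem_lowerPowers hQ
      omega
    obtain ⟨R, hR, hRe⟩ := exists_map_expPoly_linearForm_pow_add hμ hf hT n v hQ
    set B := fderiv ℂ f z₀ v
    have hstep1 : ‖expPoly hμ (f z₀) (linearForm B ^ n + R)‖ ≤
        ‖T‖ * (C ^ n * ‖q (expPoly hμ 0 (linearForm v ^ n))‖) := by
      rw [← hRe, ← hQe]
      exact (T.le_opNorm _).trans (by gcongr; exact hn1 _ (hdeg v hQ))
    have hstep2 : ‖expPoly hμ 0 (linearForm B ^ n + R)‖ ≤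
        C ^ n * ‖expPoly hμ (f z₀) (linearForm B ^ n + R)‖ := by
      have h1 := norm_expPoly_zero_sq_le hμ (f z₀) (linearForm B ^ n + R)
      have h2 := hn2 _ (hdeg B hR)
      rcases (norm_nonneg (expPoly hμ 0 (linearForm B ^ n + R))).eq_or_lt with h | h
      · rw [← h]; positivity
      · refine le_of_mul_le_mul_left ?_ h
        calc _ = ‖expPoly hμ 0 (linearForm B ^ n + R)‖ ^ 2 := (sq _).symm
          _ ≤ _ := h1
          _ ≤ (C ^ n * ‖expPoly hμ 0 (linearForm B ^ n + R)‖) *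
              ‖expPoly hμ (f z₀) (linearForm B ^ n + R)‖ := by gcongr
          _ = _ := by ring
    have hstep3 := norm_expPoly_zero_substTranspose_le hμ hc hA (linearForm B ^ n + R)
    rw [map_add, map_pow, substTranspose_linearForm, hν] at hstep3
    have hstep4 := hqle (ν • v) (substTranspose_mem_lowerPowers A hR)
    rw [linearForm_smul, smul_pow, map_smul, map_smul, norm_smul, norm_pow, ← smul_pow,
      ← linearForm_smul] at hstep4
    refine le_of_mul_le_mul_right ?_ hpos
    calc _ ≤ _ := hstep4.trans hstep3
      _ ≤ (c ^ (1 / 2 : ℝ)).toReal * (C ^ n * (‖T‖ *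
          (C ^ n * ‖q (expPoly hμ 0 (linearForm v ^ n))‖))) := by
        gcongr
        exact hstep2.trans (by gcongr)
      _ = _ := by ring
  by_contra! hlt
  have h1 : 1 < ‖ν‖ / C ^ 2 := (one_lt_div (by positivity)).2 hlt
  have h2 := (tendsto_pow_atTop_atTop_of_one_lt h1).eventually_gt_atTop
    ((c ^ (1 / 2 : ℝ)).toReal * ‖T‖)
  obtain ⟨n, h3, h4⟩ := (key.and h2).exists
  rw [div_pow, lt_div_iff₀ (by positivity)] at h4
  exact absurd h3 (not_le.2 h4)

end Jets

/-! ### From eigenvalue bounds to entry bounds through traces. -/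

theorem Matrix.norm_trace_le_of_eigenvalue_le {d : ℕ} {M : Matrix (Fin d) (Fin d) ℂ} {C : ℝ}
    (hC : ∀ (v : Fin d → ℂ) (ν : ℂ), v ≠ 0 → M.mulVec v = ν • v → ‖ν‖ ≤ C) :
    ‖M.trace‖ ≤ d * C := by
  rw [Matrix.trace_eq_sum_roots_charpoly]
  have hroot : ∀ ν ∈ M.charpoly.roots, ‖ν‖ ≤ C := fun ν hν => by
    have h1 : M.charpoly.IsRoot ν := Polynomial.isRoot_of_mem_roots hν
    rw [Polynomial.IsRoot, Matrix.eval_charpoly] at h1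
    obtain ⟨v, hv, hv0⟩ := Matrix.exists_mulVec_eq_zero_iff.2 h1
    refine hC v ν hv ?_
    rw [Matrix.sub_mulVec, Matrix.scalar_apply, Matrix.diagonal_const_mulVec, sub_eq_zero] at hv0
    exact hv0.symm
  have hcard : Multiset.card M.charpoly.roots = d := by
    rw [← (IsAlgClosed.splits M.charpoly).natDegree_eq_card_roots, Matrix.charpoly_natDegree_eq_dim,
      Fintype.card_fin]
  refine (norm_multiset_sum_le _).trans ?_
  have := Multiset.sum_le_card_nsmul (M.charpoly.roots.map fun x => ‖x‖) C fun x hx => by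
    obtain ⟨ν, hν, rfl⟩ := Multiset.mem_map.1 hx
    exact hroot ν hν
  rwa [Multiset.card_map, hcard, nsmul_eq_mul] at this

/-- If the eigenvalues of `A B` are bounded uniformly in `B`, for all `A` in a spanning set, then
the entries of the `B` are bounded. -/
theorem exists_entry_bound_of_eigenvalue_le {d : ℕ} {G : Set (Matrix (Fin d) (Fin d) ℝ)}
    (hG : Submodule.span ℝ G = ⊤) (𝓑 : Set (Matrix (Fin d) (Fin d) ℂ)) {C : ℝ}
    (hC : ∀ A ∈ G, ∀ B ∈ 𝓑, ∀ (v : Fin d → ℂ) (ν : ℂ), v ≠ 0 →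
      (A.map Complex.ofReal * B).mulVec v = ν • v → ‖ν‖ ≤ C) :
    ∃ M : ℝ, ∀ B ∈ 𝓑, ∀ i j, ‖B i j‖ ≤ M := by
  -- Unlike the eigenvalues, the trace is linear in `X`, so its bound passes from `G` to the span.
  -- Matrix units then read off the entries of `B`.
  have h : ∀ X : Matrix (Fin d) (Fin d) ℝ, ∃ K : ℝ, ∀ B ∈ 𝓑,
      ‖(X.map Complex.ofReal * B).trace‖ ≤ K := by
    intro X
    have hX : X ∈ Submodule.span ℝ G := hG ▸ Submodule.mem_top
    induction hX using Submodule.span_induction with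
    | mem A hA =>
      exact ⟨d * C, fun B hB => Matrix.norm_trace_le_of_eigenvalue_le fun v ν => hC A hA B hB v ν⟩
    | zero => exact ⟨0, fun B _ => by simp⟩
    | add X Y _ _ hX hY =>
      obtain ⟨K, hK⟩ := hX
      obtain ⟨K', hK'⟩ := hY
      refine ⟨K + K', fun B hB => ?_⟩
      rw [Matrix.map_add _ Complex.ofReal_add, add_mul, Matrix.trace_add]
      exact (norm_add_le _ _).trans (add_le_add (hK B hB) (hK' B hB))
    | smul a X _ hX =>
      obtain ⟨K, hK⟩ := hX
      refine ⟨|a| * K, fun B hB => ?_⟩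
      have : (a • X).map Complex.ofReal = (a : ℂ) • X.map Complex.ofReal := by
        ext i j; simp
      rw [this, smul_mul_assoc, Matrix.trace_smul, norm_smul, Complex.norm_real, Real.norm_eq_abs]
      gcongr
      exact hK B hB
  choose K hK using h
  refine ⟨∑ i, ∑ j, |K (Matrix.single j i 1)|, fun B hB i j => ?_⟩
  have h1 := hK (Matrix.single j i 1) B hB
  have h2 : ((Matrix.single j i (1 : ℝ)).map Complex.ofReal * B).trace = B i j := by
    have h3 : (Matrix.single j i (1 : ℝ)).map Complex.ofReal = Matrix.single j i (1 : ℂ) := by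
      ext a b
      simp only [Matrix.map_apply, Matrix.single_apply]
      split_ifs <;> simp
    rw [h3, Matrix.trace_single_mul]
    simp
  rw [h2] at h1
  calc ‖B i j‖ ≤ |K (Matrix.single j i 1)| := h1.trans (le_abs_self _)
    _ ≤ ∑ j, |K (Matrix.single j i 1)| :=
      Finset.single_le_sum (f := fun j => |K (Matrix.single j i 1)|)
        (fun _ _ => abs_nonneg _) (Finset.mem_univ j)
    _ ≤ _ := Finset.single_le_sum (f := fun i => ∑ j, |K (Matrix.single j i 1)|)
        (fun _ _ => Finset.sum_nonneg fun _ _ => abs_nonneg _) (Finset.mem_univ i)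

/-! ### Density of real-frequency exponentials in `L²` of a finite measure. -/

section Density

variable {d : ℕ}

/-- The finite measures with densities `h⁺` and `h⁻` have the same characteristic function, hence
coincide. -/
theorem ae_eq_zero_of_integral_mul_exp_eq_zero {ν : Measure (EuclideanSpace ℝ (Fin d))}
    [IsFiniteMeasure ν] {h : EuclideanSpace ℝ (Fin d) → ℝ} (hh : Integrable h ν)
    (h0 : ∀ t : EuclideanSpace ℝ (Fin d),
      ∫ ξ, (h ξ : ℂ) * Complex.exp (inner ℝ ξ t * Complex.I) ∂ν = 0) : h =ᵐ[ν] 0 := by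
  have hfin : ∀ {g : EuclideanSpace ℝ (Fin d) → ℝ}, Integrable g ν →
      IsFiniteMeasure (ν.withDensity fun ξ => ENNReal.ofReal (g ξ)) := fun hg =>
    isFiniteMeasure_withDensity_ofReal hg.2
  have hchar : ∀ {g : EuclideanSpace ℝ (Fin d) → ℝ}, Integrable g ν → ∀ t,
      charFun (ν.withDensity fun ξ => ENNReal.ofReal (g ξ)) t =
        ∫ ξ, ((max (g ξ) 0 : ℝ) : ℂ) * Complex.exp (inner ℝ ξ t * Complex.I) ∂ν := by
    intro g hg t
    rw [charFun_apply, integral_withDensity_eq_integral_toReal_smul₀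
      hg.aemeasurable.ennreal_ofReal (.of_forall fun _ => ENNReal.ofReal_lt_top)]
    rfl
  have := hfin hh
  have := hfin hh.neg
  have heq : (ν.withDensity fun ξ => ENNReal.ofReal (h ξ)) =
      ν.withDensity fun ξ => ENNReal.ofReal ((-h) ξ) := by
    refine Measure.ext_of_charFun (funext fun t => ?_)
    rw [hchar hh, hchar hh.neg, ← sub_eq_zero, ← integral_sub, ← h0 t]
    · congr 1
      ext ξ
      rw [← sub_mul, ← Complex.ofReal_sub]
      congr 2
      rcases le_total (h ξ) 0 with hξ | hξ <;> simp [hξ]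
    all_goals
      refine (Integrable.ofReal ?_).mul_bdd (c := 1) ?_ ?_
      · first | exact hh.pos_part | exact hh.neg.pos_part
      · fun_prop
      · exact .of_forall fun ξ => by simp [Complex.norm_exp_ofReal_mul_I]
  have hae := (withDensity_eq_iff hh.aemeasurable.ennreal_ofReal
    hh.neg.aemeasurable.ennreal_ofReal hh.lintegral_lt_top.ne).1 heq
  filter_upwards [hae] with ξ hξ
  rcases le_total (h ξ) 0 with hs | hs
  · rw [ENNReal.ofReal_of_nonpos hs] at hξ
    have := ENNReal.ofReal_eq_zero.1 hξ.symm
    simp only [Pi.neg_apply, Pi.zero_apply] at this ⊢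
    linarith
  · have h2 : ENNReal.ofReal ((-h) ξ) = 0 := ENNReal.ofReal_of_nonpos (by simpa using hs)
    rw [h2] at hξ
    have := ENNReal.ofReal_eq_zero.1 hξ
    simp only [Pi.zero_apply]
    linarith

/-- If `g` is orthogonal to all exponentials, so is its conjugate, by the symmetry `t ↦ -t`. Thus
the real and imaginary parts fall under the uniqueness lemma for real functions. -/
theorem span_expPoly_complexify_dense {ν : Measure (EuclideanSpace ℝ (Fin d))} [IsFiniteMeasure ν]
    (hν : HasExpMoments ν) :
    (Submodule.span ℂ (Set.range fun x : EuclideanSpace ℝ (Fin d) =>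
      expPoly hν (complexify x) 1)).topologicalClosure = ⊤ := by
  refine Submodule.topologicalClosure_eq_top_iff.2 ((Submodule.eq_bot_iff _).2 fun g hg => ?_)
  have hgi : Integrable g ν := (Lp.memLp g).integrable one_le_two
  have h1 : ∀ t : EuclideanSpace ℝ (Fin d),
      ∫ ξ, g ξ * Complex.exp (inner ℝ ξ t * Complex.I) ∂ν = 0 := by
    intro t
    have := (Submodule.mem_orthogonal _ _).1 hg _
      (Submodule.subset_span ⟨(2 * Real.pi)⁻¹ • t, rfl⟩)
    rw [← this, L2.inner_def]
    refine integral_congr_ae ?_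
    filter_upwards [coeFn_expPoly hν (complexify ((2 * Real.pi)⁻¹ • t)) 1] with ξ hξ
    have hs : (starRingEnd ℂ) (-2 * Real.pi * Complex.I *
        polyFun (linearForm (complexify ((2 * Real.pi)⁻¹ • t))) ξ) =
        inner ℝ ξ t * Complex.I := by
      simp only [polyFun_linearForm, complexify, PiLp.inner_apply, map_mul, map_sum, map_neg,
        Complex.conj_I, Complex.conj_ofReal, Complex.conj_ofNat, PiLp.smul_apply, smul_eq_mul,
        Complex.ofReal_sum, Finset.mul_sum, Finset.sum_mul]
      refine Finset.sum_congr rfl fun i _ => ?_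
      have : (Real.pi : ℂ) ≠ 0 := by exact_mod_cast Real.pi_ne_zero
      simp
      field_simp
    simp only [RCLike.inner_apply]
    rw [hξ, expMul_eq, polyFun_one, mul_one, ← Complex.exp_conj, hs]
  have hint : ∀ t : EuclideanSpace ℝ (Fin d),
      Integrable (fun ξ => g ξ * Complex.exp (inner ℝ ξ t * Complex.I)) ν := fun t =>
    hgi.mul_bdd (c := 1) (by fun_prop)
      (.of_forall fun ξ => by simp [Complex.norm_exp_ofReal_mul_I])
  have h2 : ∀ t : EuclideanSpace ℝ (Fin d),
      ∫ ξ, star (g ξ) * Complex.exp (inner ℝ ξ t * Complex.I) ∂ν = 0 := by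
    intro t
    have := congrArg star (h1 (-t))
    rw [star_zero, Complex.star_def, ← integral_conj] at this
    rw [← this]
    congr 1
    ext ξ
    rw [map_mul, ← Complex.exp_conj]
    simp
  have hint2 : ∀ t : EuclideanSpace ℝ (Fin d),
      Integrable (fun ξ => star (g ξ) * Complex.exp (inner ℝ ξ t * Complex.I)) ν := fun t =>
    Integrable.mul_bdd (c := 1) (hgi.norm.mono' hgi.1.star (.of_forall fun ξ => by simp))
      (by fun_prop)
      (.of_forall fun ξ => by simp [Complex.norm_exp_ofReal_mul_I])
  have hre := ae_eq_zero_of_integral_mul_exp_eq_zero hgi.re fun t => by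
    have := (integral_add (hint t) (hint2 t)).trans (by rw [h1, h2, add_zero])
    have h3 := congrArg (fun s => (1 / 2 : ℂ) * s) this
    simp only [mul_zero, ← integral_const_mul] at h3
    rw [← h3]
    congr 1
    ext ξ
    rw [← add_mul, ← mul_assoc]
    congr 1
    apply Complex.ext <;> simp <;> ring
  have him := ae_eq_zero_of_integral_mul_exp_eq_zero hgi.im fun t => by
    have := (integral_sub (hint t) (hint2 t)).trans (by rw [h1, h2, sub_zero])
    have h3 := congrArg (fun s => (1 / (2 * Complex.I) : ℂ) * s) this
    simp only [mul_zero, ← integral_const_mul] at h3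
    rw [← h3]
    congr 1
    ext ξ
    rw [← sub_mul, ← mul_assoc]
    congr 1
    rw [div_mul_eq_mul_div, eq_div_iff (by simp)]
    apply Complex.ext <;> simp <;> ring
  refine (Lp.eq_zero_iff_ae_eq_zero).2 ?_
  filter_upwards [hre, him] with ξ h3 h4
  exact Complex.ext h3 h4

end Density

/-! ### Affine symbols and domination of the image measure. -/

section Domination

variable {d : ℕ} {μ : Measure (EuclideanSpace ℝ (Fin d))} (hμ : HasExpMoments μ)

/-- The invertible matrices `A` such that the image of `μ` under `Aᵀ` is bounded by a multiple of
`μ`. -/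
def dominatedMatrices (μ : Measure (EuclideanSpace ℝ (Fin d))) :
    Set (Matrix (Fin d) (Fin d) ℝ) :=
  {A | IsUnit A ∧ ∃ c : ℝ≥0∞, c ≠ ∞ ∧ μ.map (Matrix.toEuclideanLin A.transpose) ≤ c • μ}

theorem one_mem_dominatedMatrices : (1 : Matrix (Fin d) (Fin d) ℝ) ∈ dominatedMatrices μ := by
  refine ⟨isUnit_one, 1, ENNReal.one_ne_top, ?_⟩
  have : ⇑(Matrix.toEuclideanLin (1 : Matrix (Fin d) (Fin d) ℝ).transpose) = id := by
    ext x i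
    simp
  rw [this, Measure.map_id, one_smul]

theorem HasExpMoments.map (hμ : HasExpMoments μ) (L : EuclideanSpace ℝ (Fin d) →L[ℝ]
    EuclideanSpace ℝ (Fin d)) : HasExpMoments (μ.map L) := fun a => by
  rw [integrable_map_measure (by fun_prop) L.continuous.aemeasurable]
  refine (hμ (|a| * ‖L‖)).mono' (by fun_prop) (.of_forall fun ξ => ?_)
  simp only [Function.comp_apply, Real.norm_of_nonneg (Real.exp_pos _).le]
  refine Real.exp_le_exp.2 ?_
  calc a * ‖L ξ‖ ≤ |a| * (‖L‖ * ‖ξ‖) :=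
        mul_le_mul (le_abs_self a) (L.le_opNorm ξ) (norm_nonneg _) (abs_nonneg a)
    _ = _ := by ring

theorem HasExpMoments.add {ν : Measure (EuclideanSpace ℝ (Fin d))} (hμ : HasExpMoments μ)
    (hν : HasExpMoments ν) : HasExpMoments (μ + ν) := fun a => (hμ a).add_measure (hν a)

/-- The exponential sum with coefficients `c`. -/
noncomputable def expSum (c : EuclideanSpace ℝ (Fin d) →₀ ℂ) (ξ : EuclideanSpace ℝ (Fin d)) : ℂ :=
  c.sum fun x a => a * expMul (complexify x) (polyFun 1) ξ

theorem continuous_expSum (c : EuclideanSpace ℝ (Fin d) →₀ ℂ) : Continuous (expSum c) := by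
  unfold expSum Finsupp.sum
  exact continuous_finsetSum _ fun x _ =>
    continuous_const.mul (continuous_expMul _ (continuous_polyFun 1))

theorem coeFn_sum_smul_expPoly (c : EuclideanSpace ℝ (Fin d) →₀ ℂ)
    (g : EuclideanSpace ℝ (Fin d) → Fin d → ℂ) :
    (c.sum fun x a => a • expPoly hμ (g x) 1 : Lp ℂ 2 μ) =ᵐ[μ]
      fun ξ => c.sum fun x a => a * expMul (g x) (polyFun 1) ξ := by
  have h1 := (ae_all_iff (ι := c.support)).2 fun x => coeFn_expPoly hμ (g x) 1
  have h2 := (ae_all_iff (ι := c.support)).2 fun x => Lp.coeFn_smul (p := 2) (μ := μ) (c x)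
    (expPoly hμ (g x) 1)
  let F : EuclideanSpace ℝ (Fin d) → Lp ℂ 2 μ := fun x => c x • expPoly hμ (g x) 1
  filter_upwards [h1, h2, Lp.coeFn_fun_finsetSum c.support F] with ξ h1 h2 h3
  rw [Finsupp.sum, Finsupp.sum, h3]
  refine Finset.sum_congr rfl fun x hx => ?_
  rw [h2 ⟨x, hx⟩, Pi.smul_apply, h1 ⟨x, hx⟩, smul_eq_mul]

theorem norm_expMul_complexify (x : EuclideanSpace ℝ (Fin d)) (h : EuclideanSpace ℝ (Fin d) → ℂ)
    (ξ : EuclideanSpace ℝ (Fin d)) : ‖expMul (complexify x) h ξ‖ = ‖h ξ‖ := by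
  have : -2 * Real.pi * Complex.I * polyFun (linearForm (complexify x)) ξ =
      ((-2 * Real.pi * ∑ i, x i * ξ i : ℝ) : ℂ) * Complex.I := by
    rw [polyFun_linearForm]
    simp only [complexify]
    push_cast
    ring
  rw [expMul_eq, norm_mul, this, Complex.norm_exp_ofReal_mul_I, one_mul]

/-- The factor coming from `b` is unimodular, so the translation is invisible in norms and only the
image of `μ` under `Aᵀ` matters. -/
theorem expMul_complexify_affine (A : Matrix (Fin d) (Fin d) ℝ) (x b ξ : EuclideanSpace ℝ (Fin d)) :
    expMul (complexify (Matrix.toEuclideanLin A x + b)) (polyFun 1) ξ =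
      expMul (complexify x) (polyFun 1) (Matrix.toEuclideanLin A.transpose ξ) *
        expMul (complexify b) (polyFun 1) ξ := by
  simp only [expMul_eq, polyFun_one, mul_one, ← Complex.exp_add, ← mul_add]
  congr 2
  rw [complexify_add]
  have h1 : ∀ v w : Fin d → ℂ, polyFun (linearForm (v + w)) ξ =
      polyFun (linearForm v) ξ + polyFun (linearForm w) ξ := fun v w => by
    simp [polyFun_linearForm, add_mul, Finset.sum_add_distrib]
  rw [h1]
  congr 1
  rw [← polyFun_substTranspose, substTranspose_linearForm]
  congr 2
  ext i
  simp [complexify, Matrix.toLpLin_apply, Matrix.mulVec, dotProduct]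

theorem eLpNorm_expSum_affine {A : Matrix (Fin d) (Fin d) ℝ} {b : EuclideanSpace ℝ (Fin d)}
    (c : EuclideanSpace ℝ (Fin d) →₀ ℂ) :
    eLpNorm (fun ξ => c.sum fun x a =>
      a * expMul (complexify (Matrix.toEuclideanLin A x + b)) (polyFun 1) ξ) 2 μ =
    eLpNorm (expSum c) 2 (μ.map (Matrix.toEuclideanLin A.transpose)) := by
  rw [eLpNorm_map_measure (continuous_expSum c).aestronglyMeasurable
    (continuous_toEuclideanLin _).aemeasurable]
  refine eLpNorm_congr_norm_ae (.of_forall fun ξ => ?_)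
  have : (c.sum fun x a =>
      a * expMul (complexify (Matrix.toEuclideanLin A x + b)) (polyFun 1) ξ) =
      expSum c (Matrix.toEuclideanLin A.transpose ξ) * expMul (complexify b) (polyFun 1) ξ := by
    simp only [expSum, Finsupp.sum, Finset.sum_mul, expMul_complexify_affine, mul_assoc]
  rw [this, norm_mul, norm_expMul_complexify, polyFun_one, norm_one, mul_one]
  rfl

/-- A bound for the `L²` norms of exponential sums implies a bound between measures. -/
theorem measure_le_of_eLpNorm_expSum_le {ν : Measure (EuclideanSpace ℝ (Fin d))}
    [IsFiniteMeasure μ] [IsFiniteMeasure ν] (hμ : HasExpMoments μ) (hν : HasExpMoments ν)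
    {M : ℝ≥0∞} (hM : M ≠ ∞)
    (h : ∀ c, eLpNorm (expSum c) 2 ν ≤ M * eLpNorm (expSum c) 2 μ) : ν ≤ M ^ 2 • μ := by
  -- Density is used in `L²(ν + μ)`, so that one exponential sum approximates `φ` for both measures
  -- at once. Indicator functions, after squaring, then give the measure inequality.
  have hall : ∀ φ : Lp ℂ 2 (ν + μ), eLpNorm φ 2 ν ≤ M * eLpNorm φ 2 μ := by
    intro φ
    refine ENNReal.le_of_forall_pos_le_add fun ε hε _ => ?_
    have hM1 : (1 + M) ≠ 0 := by simp
    have hM2 : (1 + M) ≠ ∞ := ENNReal.add_ne_top.2 ⟨ENNReal.one_ne_top, hM⟩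
    -- The approximation error enters once directly through `ν` and once, multiplied by `M`, through
    -- `μ`.
    set δ : ℝ≥0∞ := ε / (1 + M) with hδ
    have hδ0 : 0 < δ := ENNReal.div_pos (by exact_mod_cast hε.ne') hM2
    have hmem : φ ∈ (Submodule.span ℂ (Set.range fun x : EuclideanSpace ℝ (Fin d) =>
        expPoly (hν.add hμ) (complexify x) 1)).topologicalClosure := by
      rw [span_expPoly_complexify_dense]; trivial
    obtain ⟨ψ, hψ, hdist⟩ := EMetric.mem_closure_iff.1 hmem δ hδ0
    obtain ⟨c, rfl⟩ := (Finsupp.mem_span_range_iff_exists_finsupp).1 hψ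
    have hae : eLpNorm (fun ξ => φ ξ - expSum c ξ) 2 (ν + μ) < δ := by
      rw [Lp.edist_def] at hdist
      refine lt_of_le_of_lt (le_of_eq (eLpNorm_congr_ae ?_)) hdist
      filter_upwards [coeFn_sum_smul_expPoly (hν.add hμ) c complexify] with ξ hξ
      rw [Pi.sub_apply, hξ]
      rfl
    have hmν : AEStronglyMeasurable φ ν :=
      (Lp.aestronglyMeasurable φ).mono_measure (Measure.le_add_right le_rfl)
    have hmμ : AEStronglyMeasurable φ μ :=
      (Lp.aestronglyMeasurable φ).mono_measure (Measure.le_add_left le_rfl)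
    have hcs := continuous_expSum c
    have h1 : eLpNorm (fun ξ => φ ξ - expSum c ξ) 2 ν ≤ δ :=
      (eLpNorm_mono_measure _ (Measure.le_add_right le_rfl)).trans hae.le
    have h2 : eLpNorm (fun ξ => φ ξ - expSum c ξ) 2 μ ≤ δ :=
      (eLpNorm_mono_measure _ (Measure.le_add_left le_rfl)).trans hae.le
    have h3 : eLpNorm φ 2 ν ≤ δ + eLpNorm (expSum c) 2 ν := by
      have := eLpNorm_add_le (hmν.sub hcs.aestronglyMeasurable) (hcs.aestronglyMeasurable (μ := ν))
        one_le_two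
      rw [sub_add_cancel] at this
      exact this.trans (by gcongr; exact h1)
    have h4 : eLpNorm (expSum c) 2 μ ≤ eLpNorm φ 2 μ + δ := by
      have := eLpNorm_sub_le hmμ (hmμ.sub hcs.aestronglyMeasurable) one_le_two
      rw [sub_sub_cancel] at this
      exact this.trans (by gcongr; exact h2)
    calc eLpNorm φ 2 ν ≤ δ + M * (eLpNorm φ 2 μ + δ) :=
          h3.trans (by gcongr; exact (h c).trans (by gcongr))
      _ = M * eLpNorm φ 2 μ + (1 + M) * δ := by ring
      _ = M * eLpNorm φ 2 μ + ε := by rw [hδ, ENNReal.mul_div_cancel hM1 hM2]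
  refine Measure.le_intro fun s hs _ => ?_
  have := hall (indicatorConstLp 2 hs (measure_ne_top _ _) (1 : ℂ))
  have hind : ∀ {ρ : Measure (EuclideanSpace ℝ (Fin d))}, ρ ≤ ν + μ →
      eLpNorm (indicatorConstLp 2 hs (measure_ne_top (ν + μ) _) (1 : ℂ)) 2 ρ =
        ρ s ^ (1 / 2 : ℝ) := fun {ρ} hρ => by
    rw [eLpNorm_congr_ae (ae_mono hρ indicatorConstLp_coeFn),
      eLpNorm_indicator_const hs (by simp) (by simp)]
    simp
  rw [hind (Measure.le_add_right le_rfl), hind (Measure.le_add_left le_rfl)] at this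
  have h2 := ENNReal.rpow_le_rpow this (z := 2) (by norm_num)
  rw [ENNReal.mul_rpow_of_nonneg _ _ (by norm_num), ← ENNReal.rpow_mul, ← ENNReal.rpow_mul] at h2
  simpa using h2

/-- If `T` maps the exponentials with frequencies `x` to those with frequencies `A x + b`, then
`A` is invertible and `Aᵀ` maps `μ` to a measure bounded by a multiple of `μ`. -/
theorem mem_dominatedMatrices_of_affine [IsFiniteMeasure μ] (hac : μ ≪ volume) (h0 : μ ≠ 0)
    {T : Lp ℂ 2 μ →L[ℂ] Lp ℂ 2 μ} {A : Matrix (Fin d) (Fin d) ℝ} {b : EuclideanSpace ℝ (Fin d)}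
    (hT : ∀ x, T (expPoly hμ (complexify x) 1) =
      expPoly hμ (complexify (Matrix.toEuclideanLin A x + b)) 1) : A ∈ dominatedMatrices μ := by
  have hle : μ.map (Matrix.toEuclideanLin A.transpose) ≤ ‖T‖ₑ ^ 2 • μ := by
    have hexp : HasExpMoments (μ.map (Matrix.toEuclideanLin A.transpose)) :=
      hμ.map (LinearMap.toContinuousLinearMap (Matrix.toEuclideanLin A.transpose))
    refine measure_le_of_eLpNorm_expSum_le hμ hexp enorm_ne_top fun c => ?_
    rw [← eLpNorm_expSum_affine (b := b), ← eLpNorm_congr_ae (coeFn_sum_smul_expPoly hμ c _)]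
    have h1 : eLpNorm (expSum c) 2 μ = ‖(c.sum fun x a => a • expPoly hμ (complexify x) 1 :
        Lp ℂ 2 μ)‖ₑ := by
      rw [Lp.enorm_def]
      exact (eLpNorm_congr_ae (coeFn_sum_smul_expPoly hμ c complexify)).symm
    rw [h1, ← Lp.enorm_def]
    have h2 : (c.sum fun x a => a • expPoly hμ (complexify (Matrix.toEuclideanLin A x + b)) 1) =
        T (c.sum fun x a => a • expPoly hμ (complexify x) 1) := by
      simp only [Finsupp.sum, map_sum, map_smul, hT]
    rw [h2]
    exact T.le_opENorm _
  refine ⟨?_, _, ENNReal.pow_ne_top enorm_ne_top, hle⟩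
  -- For singular `A` the image measure lives on a proper subspace, which is Lebesgue null and so
  -- `μ`-null. Domination would then force `μ = 0`.
  by_contra hA
  let R : Submodule ℝ (EuclideanSpace ℝ (Fin d)) :=
    LinearMap.range (Matrix.toEuclideanLin A.transpose)
  have hR : R ≠ ⊤ := by
    intro hR
    refine hA ?_
    have hsurj : Function.Surjective (Matrix.toEuclideanLin A.transpose) :=
      LinearMap.range_eq_top.1 hR
    rw [← Matrix.isUnit_transpose]
    refine Matrix.mulVec_surjective_iff_isUnit.1 fun y => ?_
    obtain ⟨x, hx⟩ := hsurj (WithLp.toLp 2 y)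
    exact ⟨WithLp.ofLp x, by simpa [Matrix.toLpLin_apply] using congrArg WithLp.ofLp hx⟩
  have h1 : μ (R : Set (EuclideanSpace ℝ (Fin d))) = 0 :=
    hac (Measure.addHaar_submodule volume R hR)
  have h2 := hle (R : Set (EuclideanSpace ℝ (Fin d)))
  rw [Measure.smul_apply, h1, smul_zero, Measure.map_apply
    (continuous_toEuclideanLin _).measurable R.closed_of_finiteDimensional.measurableSet] at h2
  have h3 : (Matrix.toEuclideanLin A.transpose) ⁻¹' (R : Set (EuclideanSpace ℝ (Fin d))) =
      Set.univ := Set.eq_univ_of_forall fun x => LinearMap.mem_range_self _ x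
  rw [h3] at h2
  exact h0 (Measure.measure_univ_eq_zero.1 (le_antisymm h2 bot_le))

/-- Conversely, an admissible affine map induces a bounded operator. -/
theorem exists_clm_of_mem_dominatedMatrices {A : Matrix (Fin d) (Fin d) ℝ}
    (hA : A ∈ dominatedMatrices μ) (b : EuclideanSpace ℝ (Fin d)) :
    ∃ T : Lp ℂ 2 μ →L[ℂ] Lp ℂ 2 μ, ∀ x, T (expPoly hμ (complexify x) 1) =
      expPoly hμ (complexify (Matrix.toEuclideanLin A x + b)) 1 := by
  obtain ⟨-, c, hc, hle⟩ := hA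
  refine exists_clm_of_norm_linearCombination_le _ _ (c ^ (1 / 2 : ℝ)).toReal fun a => ?_
  rw [Finsupp.linearCombination_apply, Finsupp.linearCombination_apply, Lp.norm_def, Lp.norm_def,
    ← ENNReal.toReal_mul]
  refine ENNReal.toReal_mono (ENNReal.mul_ne_top (ENNReal.rpow_ne_top_of_nonneg (by simp) hc)
    (Lp.eLpNorm_ne_top _)) ?_
  rw [eLpNorm_congr_ae (coeFn_sum_smul_expPoly hμ a _), eLpNorm_expSum_affine,
    eLpNorm_congr_ae (coeFn_sum_smul_expPoly hμ a _)]
  refine (eLpNorm_mono_measure _ hle).trans (le_of_eq ?_)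
  rw [eLpNorm_smul_measure_of_ne_top (by simp)]
  simp only [smul_eq_mul]
  congr 2
  simp

end Domination

/-! ### Maps inducing bounded operators are affine. -/

section Rigidity

variable {d : ℕ} {μ : Measure (EuclideanSpace ℝ (Fin d))} (hμ : HasExpMoments μ)

/-- The eigenvalue bound `C²` involves neither `‖T‖` nor the domination constant of `A`. This
uniformity serves both the continuation of lifts and Liouville's theorem. -/
theorem exists_norm_fderiv_le (hac : μ ≪ volume) (h0 : μ ≠ 0) {C : ℝ} (hC : 1 ≤ C)
    (hB : ExpGrowthBound hμ C) (hspan : Submodule.span ℝ (dominatedMatrices μ) = ⊤) :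
    ∃ M : ℝ, ∀ (T : Lp ℂ 2 μ →L[ℂ] Lp ℂ 2 μ) (f : (Fin d → ℂ) → Fin d → ℂ) (z : Fin d → ℂ),
      (∀ᶠ z' in 𝓝 z, DifferentiableAt ℂ f z' ∧ T (expPoly hμ z' 1) = expPoly hμ (f z') 1) →
        ‖fderiv ℂ f z‖ ≤ M := by
  let 𝓑 : Set (Matrix (Fin d) (Fin d) ℂ) := {B | ∃ (T : Lp ℂ 2 μ →L[ℂ] Lp ℂ 2 μ)
    (f : (Fin d → ℂ) → Fin d → ℂ) (z : Fin d → ℂ),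
      (∀ᶠ z' in 𝓝 z, DifferentiableAt ℂ f z' ∧ T (expPoly hμ z' 1) = expPoly hμ (f z') 1) ∧
        B = LinearMap.toMatrix' (fderiv ℂ f z : (Fin d → ℂ) →ₗ[ℂ] Fin d → ℂ)}
  obtain ⟨M, hM⟩ := exists_entry_bound_of_eigenvalue_le hspan 𝓑 (C := C ^ 2) (by
    rintro A ⟨-, c, hc, hA⟩ _ ⟨T, f, z, hf, rfl⟩ v ν hv hν
    refine norm_eigenvalue_le hμ hac h0 hC hB hf.self_of_nhds.1 (hf.mono fun _ h => h.2) hc hA hv ?_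
    rw [← hν, ← Matrix.mulVec_mulVec, LinearMap.toMatrix'_mulVec]
    rfl)
  refine ⟨∑ _i : Fin d, ∑ _j : Fin d, |M|, fun T f z hf => ?_⟩
  refine ContinuousLinearMap.opNorm_le_bound _ (by positivity) fun v => ?_
  have hBv : fderiv ℂ f z v =
      (LinearMap.toMatrix' (fderiv ℂ f z : (Fin d → ℂ) →ₗ[ℂ] Fin d → ℂ)).mulVec v := by
    rw [LinearMap.toMatrix'_mulVec]
    rfl
  refine (pi_norm_le_iff_of_nonneg (by positivity)).2 fun i => ?_
  rw [hBv, Matrix.mulVec, dotProduct]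
  calc _ ≤ ∑ j, |M| * ‖v‖ := by
        refine (norm_sum_le _ _).trans (Finset.sum_le_sum fun j _ => ?_)
        rw [norm_mul]
        exact mul_le_mul ((hM _ ⟨T, f, z, hf, rfl⟩ i j).trans (le_abs_self M)) (norm_le_pi_norm v j)
          (norm_nonneg _) (abs_nonneg _)
    _ = (∑ _j : Fin d, |M|) * ‖v‖ := by rw [Finset.sum_mul]
    _ ≤ _ := by
        refine mul_le_mul_of_nonneg_right ?_ (norm_nonneg v)
        exact Finset.single_le_sum (f := fun _ : Fin d => ∑ _j : Fin d, |M|)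
          (fun _ _ => by positivity) (Finset.mem_univ i)

/-- A complex linear map which maps real vectors to real vectors is the complexification of a
real matrix. -/
theorem exists_matrix_of_forall_exists_complexify {L : (Fin d → ℂ) →L[ℂ] Fin d → ℂ}
    (h : ∀ v : EuclideanSpace ℝ (Fin d), ∃ u : EuclideanSpace ℝ (Fin d),
      L (complexify v) = complexify u) :
    ∃ A : Matrix (Fin d) (Fin d) ℝ, ∀ v, L (complexify v) =
      complexify (Matrix.toEuclideanLin A v) := by
  choose u hu using h
  let U : EuclideanSpace ℝ (Fin d) →ₗ[ℝ] EuclideanSpace ℝ (Fin d) :=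
    { toFun := u
      map_add' := fun x y => complexify_injective (by
        rw [← hu, complexify_add, map_add, hu, hu, complexify_add])
      map_smul' := fun t x => complexify_injective (by
        rw [← hu, complexify_smul, map_smul, hu, RingHom.id_apply, complexify_smul]) }
  refine ⟨Matrix.toEuclideanLin.symm U, fun v => ?_⟩
  rw [LinearEquiv.apply_symm_apply]
  exact hu v

/-- A map inducing a bounded operator on the exponentials is affine. -/
theorem exists_affine_of_clm [IsFiniteMeasure μ] (hac : μ ≪ volume) (h0 : μ ≠ 0) {C : ℝ}
    (hC : 1 ≤ C) (hB : ExpGrowthBound hμ C)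
    (hspan : Submodule.span ℝ (dominatedMatrices μ) = ⊤) {U : Set (EuclideanSpace ℝ (Fin d))}
    (hU : IsOpen U) (f : U → EuclideanSpace ℝ (Fin d)) {T : Lp ℂ 2 μ →L[ℂ] Lp ℂ 2 μ}
    (hT : ∀ x : U, T (expPoly hμ (complexify x) 1) = expPoly hμ (complexify (f x)) 1) :
    ∃ A ∈ dominatedMatrices μ, ∃ b : EuclideanSpace ℝ (Fin d),
      ∀ x : U, f x = Matrix.toEuclideanLin A (x : EuclideanSpace ℝ (Fin d)) + b := by
  rcases U.eq_empty_or_nonempty with rfl | ⟨p, hp⟩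
  -- On the empty set the condition is void and any admissible matrix serves.
  · exact ⟨1, one_mem_dominatedMatrices, 0, fun x => x.2.elim⟩
  have he : ContDiff ℂ 1 fun z => expPoly hμ z 1 := contDiff_expPoly hμ 1
  have hE : Differentiable ℂ fun z => T (expPoly hμ z 1) :=
    T.differentiable.comp (he.differentiable one_ne_zero)
  have hinj := expPoly_one_injective hμ hac h0
  have himm := fderiv_expPoly_one_injective hμ hac h0
  obtain ⟨M, hM⟩ := exists_norm_fderiv_le hμ hac h0 hC hB hspan
  -- Continuity of `f` is not assumed: it follows because convergence of the exponentials at real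
  -- frequencies forces convergence of the frequencies.
  have hcont : Tendsto f (𝓝 ⟨p, hp⟩) (𝓝 (f ⟨p, hp⟩)) := by
    refine tendsto_of_tendsto_expPoly hμ hac h0 ?_
    simp only [← hT]
    exact ((hE.continuous.comp continuous_complexify).comp continuous_subtype_val).tendsto _
  obtain ⟨F, hF, hFu⟩ := exists_local_lift he hE (himm (complexify (f ⟨p, hp⟩)))
    (hT ⟨p, hp⟩).symm
  have hreal : ∀ᶠ x in 𝓝 p, T (expPoly hμ (complexify x) 1) = expPoly hμ (F (complexify x)) 1 := by
    have h1 : ∀ᶠ x : U in 𝓝 ⟨p, hp⟩, T (expPoly hμ (complexify (x : EuclideanSpace ℝ (Fin d))) 1) =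
        expPoly hμ (F (complexify (x : EuclideanSpace ℝ (Fin d)))) 1 := by
      have h2 : Tendsto (fun x : U => (complexify (x : EuclideanSpace ℝ (Fin d)),
          complexify (f x))) (𝓝 ⟨p, hp⟩) (𝓝 (complexify p) ×ˢ 𝓝 (complexify (f ⟨p, hp⟩))) :=
        ((continuous_complexify.comp continuous_subtype_val).tendsto _).prodMk
          ((continuous_complexify.tendsto _).comp hcont)
      filter_upwards [h2.eventually hFu] with x hx
      rw [hT, ← hx (hT x).symm]
    have h3 := h1
    rw [nhds_subtype_eq_comap, eventually_comap] at h3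
    filter_upwards [h3, hU.mem_nhds hp] with x hx hxU
    exact hx ⟨x, hxU⟩ rfl
  have hlift : ∀ᶠ z in 𝓝 (complexify p),
      DifferentiableAt ℂ F z ∧ T (expPoly hμ z 1) = expPoly hμ (F z) 1 := by
    refine hF.and ?_
    refine eventuallyEq_of_eventuallyEq_complexify (.of_forall fun z => hE z) ?_ hreal
    filter_upwards [hF] with z hz
    exact (he.differentiable one_ne_zero (F z)).comp z hz
  obtain ⟨g, hg, hgT⟩ := exists_differentiable_lift he hE hinj himm hlift (hM T)
  have haff := eq_add_fderiv_of_bounded_fderiv hg fun z =>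
    hM T g z (.of_forall fun z' => ⟨hg z', hgT z'⟩)
  have hgf : ∀ x : U, g (complexify x) = complexify (f x) := fun x =>
    hinj ((hgT (complexify x)).symm.trans (hT x))
  -- As `g` is affine and takes real values on `U`, difference quotients at `p` with small real
  -- steps show that its linear part is real.
  obtain ⟨A, hA⟩ := exists_matrix_of_forall_exists_complexify (L := fderiv ℂ g 0) fun v => by
    have h1 : Tendsto (fun t : ℝ => p + t • v) (𝓝[≠] 0) (𝓝 p) :=
      (Continuous.tendsto' (by fun_prop) _ _ (by simp)).mono_left nhdsWithin_le_nhds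
    obtain ⟨t, htU, ht0⟩ := ((h1.eventually (hU.mem_nhds hp)).and
      (self_mem_nhdsWithin : ∀ᶠ t : ℝ in 𝓝[≠] 0, t ≠ 0)).exists
    refine ⟨t⁻¹ • (f ⟨_, htU⟩ + (-1 : ℝ) • f ⟨p, hp⟩), ?_⟩
    have ht0' : (t : ℂ) ≠ 0 := by exact_mod_cast ht0
    have h2 := hgf ⟨_, htU⟩
    have h3 := hgf ⟨p, hp⟩
    rw [haff] at h2 h3
    simp only [complexify_add, complexify_smul, map_add, map_smul] at h2 h3 ⊢
    rw [← h2, ← h3, Complex.ofReal_inv, eq_inv_smul_iff₀ ht0']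
    push_cast
    rw [neg_smul, one_smul]
    abel
  have hb : g 0 = complexify (f ⟨p, hp⟩ + (-1 : ℝ) • Matrix.toEuclideanLin A p) := by
    have h3 := hgf ⟨p, hp⟩
    rw [haff, hA] at h3
    rw [complexify_add, complexify_smul, ← h3]
    push_cast
    rw [neg_smul, one_smul, add_neg_cancel_right]
  generalize f ⟨p, hp⟩ + (-1 : ℝ) • Matrix.toEuclideanLin A p = b at hb
  have hgx : ∀ x, g (complexify x) = complexify (Matrix.toEuclideanLin A x + b) := fun x => by
    rw [haff, hA, hb, complexify_add, add_comm]
  -- The relation `T e_x = e_{Ax+b}` was given on `U` only; the entire lift provides it for every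
  -- real `x`.
  refine ⟨A, mem_dominatedMatrices_of_affine hμ hac h0 (T := T) (b := b) fun x => ?_, b,
    fun x => complexify_injective ?_⟩
  · rw [hgT, hgx]
  · rw [← hgf, hgx]

end Rigidity

/-! ### Analyticity of Fourier transforms and Fourier inversion. -/

section Fourier

variable {d : ℕ}

/-- The Fourier transform of a function with finite exponential moments is analytic. -/
theorem analyticOnNhd_fourier_of_exp_moments {g : EuclideanSpace ℝ (Fin d) → ℂ}
    (hgm : AEStronglyMeasurable g)
    (hg : ∀ a : ℝ, Integrable fun ξ => Real.exp (a * ‖ξ‖) * ‖g ξ‖) :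
    AnalyticOnNhd ℝ (𝓕 g) Set.univ := by
  intro x _
  let K : ℝ := 2 * Real.pi * ‖innerSL ℝ (E := EuclideanSpace ℝ (Fin d))‖
  have hK : 0 ≤ K := by positivity
  have hterm : ∀ (n : ℕ) (s : ℝ), 0 ≤ s → ∀ ξ : EuclideanSpace ℝ (Fin d),
      (n.factorial : ℝ)⁻¹ * ((K ^ n * ‖ξ‖ ^ n * ‖g ξ‖) * s ^ n) ≤
        Real.exp (K * s * ‖ξ‖) * ‖g ξ‖ := by
    intro n s hs ξ
    have := Real.pow_div_factorial_le_exp (K * s * ‖ξ‖) (by positivity) n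
    calc _ = (K * s * ‖ξ‖) ^ n / n.factorial * ‖g ξ‖ := by rw [div_eq_inv_mul]; ring
      _ ≤ _ := by gcongr
  have hpow : ∀ n : ℕ, Integrable fun ξ => ‖ξ‖ ^ n * ‖g ξ‖ := fun n => by
    refine ((hg 1).const_mul n.factorial).mono' (by fun_prop) (.of_forall fun ξ => ?_)
    have := Real.pow_div_factorial_le_exp ‖ξ‖ (norm_nonneg _) n
    rw [div_le_iff₀' (by positivity)] at this
    rw [Real.norm_of_nonneg (by positivity), one_mul, ← mul_assoc]
    gcongr
  -- The Taylor series at `x`, obtained by expanding the Fourier character under the integral. The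
  -- exponential moments of `g` give it infinite radius of convergence.
  let p : FormalMultilinearSeries ℝ (EuclideanSpace ℝ (Fin d)) ℂ := fun n =>
    (n.factorial : ℝ)⁻¹ • 𝓕 (fun ξ => VectorFourier.fourierPowSMulRight (innerSL ℝ) g ξ n) x
  have hp : ∀ n, ‖p n‖ ≤ (n.factorial : ℝ)⁻¹ * ∫ ξ, K ^ n * ‖ξ‖ ^ n * ‖g ξ‖ := by
    intro n
    rw [norm_smul, norm_inv, Real.norm_natCast, Real.fourier_eq]
    gcongr
    refine (norm_integral_le_integral_norm _).trans ?_
    refine integral_mono_of_nonneg (.of_forall fun _ => norm_nonneg _) ?_ (.of_forall fun ξ => ?_)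
    · simpa only [mul_assoc] using (hpow n).const_mul (K ^ n)
    · simp only [Circle.norm_smul]
      exact VectorFourier.norm_fourierPowSMulRight_le _ g ξ n
  refine ⟨p, ∞, ?_, ENNReal.zero_lt_top, fun {y} _ => ?_⟩
  · refine ENNReal.le_of_forall_nnreal_lt fun r _ => ?_
    refine p.le_radius_of_bound (∫ ξ, Real.exp (K * r * ‖ξ‖) * ‖g ξ‖) fun n => ?_
    calc ‖p n‖ * (r : ℝ) ^ n ≤
          ((n.factorial : ℝ)⁻¹ * ∫ ξ, K ^ n * ‖ξ‖ ^ n * ‖g ξ‖) * (r : ℝ) ^ n := by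
            gcongr; exact hp n
      _ = ∫ ξ, (n.factorial : ℝ)⁻¹ * ((K ^ n * ‖ξ‖ ^ n * ‖g ξ‖) * (r : ℝ) ^ n) := by
            rw [integral_const_mul, integral_mul_const, mul_assoc]
      _ ≤ _ := by
            refine integral_mono_of_nonneg (.of_forall fun ξ => by positivity) (hg _)
              (.of_forall fun ξ => hterm n r r.2 ξ)
  · let F : ℕ → EuclideanSpace ℝ (Fin d) → ℂ := fun n ξ =>
      (n.factorial : ℂ)⁻¹ * ((-(2 * Real.pi * Complex.I)) ^ n * ((inner ℝ ξ y : ℝ) : ℂ) ^ n) *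
        (Real.fourierChar (-inner ℝ ξ x) • g ξ)
    let z : EuclideanSpace ℝ (Fin d) → ℂ := fun ξ => -(2 * Real.pi * Complex.I) * inner ℝ ξ y
    have hz : ∀ ξ, ‖z ξ‖ ≤ 2 * Real.pi * ‖y‖ * ‖ξ‖ := fun ξ => by
      have : ‖z ξ‖ = 2 * Real.pi * |inner ℝ ξ y| := by
        simp [z, abs_of_pos Real.pi_pos]
      rw [this]
      calc _ ≤ 2 * Real.pi * (‖ξ‖ * ‖y‖) := by gcongr; exact abs_real_inner_le_norm ξ y
        _ = _ := by ring
    have hFz : ∀ n ξ, F n ξ = z ξ ^ n / n.factorial * (Real.fourierChar (-inner ℝ ξ x) • g ξ) :=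
      fun n ξ => by simp only [F, z, mul_pow, div_eq_inv_mul]
    have hFn : ∀ n ξ, ‖F n ξ‖ = ‖z ξ‖ ^ n / n.factorial * ‖g ξ‖ := fun n ξ => by
      rw [hFz, norm_mul, Circle.norm_smul, norm_div, norm_pow, Complex.norm_natCast]
    have hzc : Continuous z := by unfold z; fun_prop
    have hgx : AEStronglyMeasurable fun ξ => Real.fourierChar (-inner ℝ ξ x) • g ξ := by
      simp only [Circle.smul_def]
      have : Continuous fun ξ : EuclideanSpace ℝ (Fin d) =>
          (Real.fourierChar (-inner ℝ ξ x) : ℂ) := by fun_prop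
      exact this.aestronglyMeasurable.smul hgm
    have hpn : ∀ n, p n (fun _ => y) = ∫ ξ, F n ξ := by
      intro n
      have hint : Integrable fun ξ => VectorFourier.fourierPowSMulRight (innerSL ℝ) g ξ n :=
        VectorFourier.integrable_fourierPowSMulRight (innerSL ℝ) (hpow n) hgm
      simp only [p]
      rw [smul_apply,
        Real.fourier_continuousMultilinearMap_apply hint, Real.fourier_eq,
        ← integral_smul]
      congr 1
      ext ξ
      rw [VectorFourier.fourierPowSMulRight_apply]
      simp only [F, Circle.smul_def, smul_eq_mul, Finset.prod_const, Finset.card_univ,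
        Fintype.card_fin, Complex.real_smul]
      rw [show (innerSL ℝ ξ) y = inner ℝ ξ y from rfl]
      push_cast
      ring
    simp only [hpn]
    have hFeq : 𝓕 g (x + y) = ∫ ξ, ∑' n, F n ξ := by
      rw [Real.fourier_eq]
      congr 1
      ext ξ
      have h1 := (NormedSpace.expSeries_div_hasSum_exp (z ξ)).mul_right
        (Real.fourierChar (-inner ℝ ξ x) • g ξ)
      rw [← Complex.exp_eq_exp_ℂ] at h1
      simp only [hFz]
      rw [h1.tsum_eq, Circle.smul_def, Circle.smul_def, smul_eq_mul, smul_eq_mul, ← mul_assoc]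
      congr 1
      rw [Real.fourierChar_apply, Real.fourierChar_apply, ← Complex.exp_add]
      congr 1
      simp only [z, inner_add_right]
      push_cast
      ring
    rw [hFeq]
    have hle : ∀ (s : Finset ℕ) (ξ : EuclideanSpace ℝ (Fin d)),
        ∑ n ∈ s, ‖F n ξ‖ ≤ Real.exp (2 * Real.pi * ‖y‖ * ‖ξ‖) * ‖g ξ‖ := fun s ξ => by
      simp only [hFn, ← Finset.sum_mul]
      gcongr
      refine (sum_le_hasSum s (fun _ _ => by positivity)
        (NormedSpace.expSeries_div_hasSum_exp ‖z ξ‖)).trans ?_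
      rw [← Real.exp_eq_exp_ℝ]
      exact Real.exp_le_exp.2 (hz ξ)
    have hFint : ∀ n, Integrable (F n) := fun n => by
      refine (hg (2 * Real.pi * ‖y‖)).mono' ?_ (.of_forall fun ξ => ?_)
      · simp only [funext (hFz n)]
        exact (by fun_prop : Continuous fun ξ => z ξ ^ n / (n.factorial : ℂ)).aestronglyMeasurable.mul
          hgx
      · simpa using hle {n} ξ
    refine hasSum_integral_of_summable_integral_norm hFint ?_
    refine summable_of_sum_le (c := ∫ ξ, Real.exp (2 * Real.pi * ‖y‖ * ‖ξ‖) * ‖g ξ‖)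
      (fun n => by positivity) fun s => ?_
    rw [← integral_finsetSum _ fun n _ => (hFint n).norm]
    exact integral_mono (integrable_finsetSum _ fun n _ => (hFint n).norm) (hg _) (hle s)

theorem integrable_exp_neg_norm : Integrable fun ξ : EuclideanSpace ℝ (Fin d) => Real.exp (-‖ξ‖) := by
  have h := integrable_one_add_norm (E := EuclideanSpace ℝ (Fin d)) (μ := volume) (r := (d + 1 : ℕ))
    (by simp)
  refine (h.const_mul ((d + 1).factorial * Real.exp 1)).mono' (by fun_prop) (.of_forall fun ξ => ?_)
  have := Real.pow_div_factorial_le_exp (1 + ‖ξ‖) (by positivity) (d + 1)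
  rw [Real.norm_of_nonneg (Real.exp_pos _).le, Real.rpow_neg (by positivity), Real.rpow_natCast,
    ← div_eq_mul_inv, le_div_iff₀ (by positivity)]
  rw [div_le_iff₀' (by positivity), Real.exp_add] at this
  calc _ ≤ Real.exp (-‖ξ‖) * ((d + 1).factorial * (Real.exp 1 * Real.exp ‖ξ‖)) := by gcongr
    _ = (d + 1).factorial * Real.exp 1 * (Real.exp (-‖ξ‖) * Real.exp ‖ξ‖) := by ring
    _ = _ := by rw [← Real.exp_add]; simp

theorem HasSuperexponentialDecay.integrable_exp_mul_norm {w : EuclideanSpace ℝ (Fin d) → ℂ}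
    (hw : HasSuperexponentialDecay w) (hm : AEStronglyMeasurable w) (a : ℝ) :
    Integrable fun ξ => Real.exp (a * ‖ξ‖) * ‖w ξ‖ := by
  -- The extra `1` leaves the integrable factor `exp (-‖ξ‖)`.
  obtain ⟨c, hc, h⟩ := hw (|a| + 1) (by positivity)
  refine (integrable_exp_neg_norm.const_mul c).mono' (by fun_prop) ?_
  filter_upwards [h] with ξ hξ
  rw [Real.norm_of_nonneg (by positivity)]
  calc _ ≤ Real.exp (|a| * ‖ξ‖) * (c * Real.exp (-(|a| + 1) * ‖ξ‖)) := by
        gcongr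
        exact le_abs_self a
    _ = c * (Real.exp (|a| * ‖ξ‖) * Real.exp (-(|a| + 1) * ‖ξ‖)) := by ring
    _ = _ := by rw [← Real.exp_add]; ring_nf

/-- Fourier inversion for continuous `L²` functions with integrable Fourier transform. -/
theorem eq_fourierInv_fourierL2 {u : EuclideanSpace ℝ (Fin d) → ℂ} (hu : Continuous u)
    (hu2 : MemLp u 2 volume) (h1 : Integrable (fourierL2 u hu2)) :
    u = 𝓕⁻ (fourierL2 u hu2) := by
  have hinner : Continuous fun p : EuclideanSpace ℝ (Fin d) × EuclideanSpace ℝ (Fin d) =>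
      (-innerₗ (EuclideanSpace ℝ (Fin d))) p.1 p.2 := by
    exact continuous_inner.neg
  have hcont : Continuous (𝓕⁻ (fourierL2 u hu2)) := by
    exact VectorFourier.fourierIntegral_continuous Real.continuous_fourierChar
      hinner h1
  -- Both sides are continuous, so equality against test functions suffices. There the inversion
  -- formula for tempered distributions applies, and the inverse transform moves off the test
  -- function by Fubini.
  refine (hu.ae_eq_iff_eq volume hcont).1 ?_
  refine ae_eq_of_integral_contDiff_smul_eq hu.locallyIntegrable hcont.locallyIntegrable
    fun φ hφ hφc => ?_
  have hφ₁ : HasCompactSupport (Complex.ofRealCLM ∘ φ) := hφc.comp_left rfl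
  have hφ₂ : ContDiff ℝ ((⊤ : ℕ∞) : WithTop ℕ∞) (Complex.ofRealCLM ∘ φ) :=
    Complex.ofRealCLM.contDiff.comp hφ
  let Φ : SchwartzMap (EuclideanSpace ℝ (Fin d)) ℂ := hφ₁.toSchwartzMap hφ₂
  have hdist := congrArg (fun S => S Φ)
    (Lp.fourierInv_toTemperedDistribution_eq (𝓕 (hu2.toLp u)))
  rw [FourierTransform.fourierInv_fourier_eq] at hdist
  simp only [TemperedDistribution.fourierInv_apply, Lp.toTemperedDistribution_apply] at hdist
  have hL : ∫ x, φ x • u x = ∫ x, Φ x • (hu2.toLp u) x := by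
    refine integral_congr_ae ?_
    filter_upwards [hu2.coeFn_toLp] with x hx
    rw [hx]
    simp [Φ]
  rw [hL, ← hdist]
  have hflip := VectorFourier.integral_fourierIntegral_smul_eq_flip (f := Φ) (g := fourierL2 u hu2)
    (μ := volume) (ν := volume) (L := -innerₗ (EuclideanSpace ℝ (Fin d)))
    Real.continuous_fourierChar hinner Φ.integrable h1
  have hflipL : (-innerₗ (EuclideanSpace ℝ (Fin d))).flip = -innerₗ (EuclideanSpace ℝ (Fin d)) := by
    ext x y
    simp [real_inner_comm]
  rw [hflipL] at hflip
  refine Eq.trans ?_ (hflip.trans ?_)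
  · rw [SchwartzMap.fourierInv_coe]
    rfl
  · refine integral_congr_ae (.of_forall fun x => ?_)
    simp only [Φ, HasCompactSupport.toSchwartzMap_toFun, Function.comp_apply, smul_eq_mul]
    rfl

end Fourier

/-! ### The spectral measure, and translation of (A), (B), (C) to it. -/

section SpectralMeasure

/-- Every measurable set is a preimage under `L.symm`, so after a change of variables with Jacobian
factor `κ` the inequality compares two integrals over the same arbitrary set. -/
theorem map_withDensity_le_smul_iff {α : Type*} [MeasurableSpace α] {ν : Measure α} [SigmaFinite ν]
    {ρ : α → ℝ≥0∞} (hρ : AEMeasurable ρ ν) (L : α ≃ᵐ α) {κ : ℝ≥0∞} (hκ0 : κ ≠ 0) (hκ : κ ≠ ∞)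
    (hL : ν.map L = κ • ν) (c : ℝ≥0∞) :
    (ν.withDensity ρ).map L ≤ c • ν.withDensity ρ ↔ ∀ᵐ x ∂ν, ρ x ≤ c * κ⁻¹ * ρ (L x) := by
  have hρL : AEMeasurable (fun x => ρ (L x)) ν := by
    refine AEMeasurable.comp_measurable ?_ L.measurable
    rw [hL]
    exact hρ.smul_measure κ
  have hr : ∀ S, MeasurableSet S →
      (c • ν.withDensity ρ) S = ∫⁻ x in L ⁻¹' S, c * κ⁻¹ * ρ (L x) ∂ν := fun S hS => by
    rw [lintegral_const_mul'' _ hρL.restrict, ← L.measurableEmbedding.lintegral_map,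
      ← L.measurableEmbedding.restrict_map, hL, Measure.restrict_smul, lintegral_smul_measure,
      smul_eq_mul, ← mul_assoc, mul_assoc c, ENNReal.inv_mul_cancel hκ0 hκ, mul_one,
      Measure.smul_apply, withDensity_apply _ hS, smul_eq_mul]
  have hl : ∀ S, MeasurableSet S →
      (ν.withDensity ρ).map L S = ∫⁻ x in L ⁻¹' S, ρ x ∂ν := fun S hS => by
    rw [Measure.map_apply L.measurable hS, withDensity_apply _ (L.measurable hS)]
  constructor
  · intro h
    refine ae_le_of_forall_setLIntegral_le_of_sigmaFinite₀ hρ fun S hS _ => ?_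
    have hS' : MeasurableSet (L.symm ⁻¹' S) := L.symm.measurable hS
    have := h (L.symm ⁻¹' S)
    rw [hr _ hS', hl _ hS', ← Set.preimage_comp] at this
    simpa using this
  · intro h
    refine Measure.le_iff.2 fun S hS => ?_
    rw [hr S hS, hl S hS]
    exact lintegral_mono_ae (ae_restrict_of_ae h)

variable {d : ℕ}

/-- The measure with density `w`, for a weight `w` with nonnegative real values. -/
noncomputable def spectralMeasure (w : EuclideanSpace ℝ (Fin d) → ℂ) :
    Measure (EuclideanSpace ℝ (Fin d)) :=
  volume.withDensity fun ξ => ENNReal.ofReal (w ξ).re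

variable {w : EuclideanSpace ℝ (Fin d) → ℂ}

theorem aemeasurable_ofReal_re (hw : AEStronglyMeasurable w) :
    AEMeasurable fun ξ => ENNReal.ofReal (w ξ).re :=
  (Complex.measurable_re.comp_aemeasurable hw.aemeasurable).ennreal_ofReal

theorem admissibleMatrices_eq (hw : AEStronglyMeasurable w) (h0 : ∀ᵐ ξ, 0 ≤ w ξ) :
    admissibleMatrices w = dominatedMatrices (spectralMeasure w) := by
  ext A
  refine and_congr_right fun hA => ?_
  have hdet : LinearMap.det (Matrix.toEuclideanLin A.transpose) ≠ 0 := by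
    rw [Matrix.toEuclideanLin, Matrix.toLpLin_eq_toLin, LinearMap.det_toLin, Matrix.det_transpose]
    exact ((Matrix.isUnit_iff_isUnit_det A).1 hA).ne_zero
  let L : EuclideanSpace ℝ (Fin d) ≃ᵐ EuclideanSpace ℝ (Fin d) :=
    (LinearMap.equivOfDetNeZero _ hdet).toContinuousLinearEquiv.toHomeomorph.toMeasurableEquiv
  have hLf : ⇑L = Matrix.toEuclideanLin A.transpose := rfl
  have hmap := Measure.map_linearMap_addHaar_eq_smul_addHaar volume hdet
  rw [← hLf] at hmap ⊢
  set κ := ENNReal.ofReal |(LinearMap.det (Matrix.toEuclideanLin A.transpose))⁻¹|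
  have hκ0 : κ ≠ 0 := by
    simpa [κ] using hdet
  have hκ : κ ≠ ∞ := ENNReal.ofReal_ne_top
  have hre : ∀ᵐ ξ, 0 ≤ (w ξ).re := by
    filter_upwards [h0] with ξ hξ using (Complex.le_def.1 hξ).1
  have hreL : ∀ᵐ ξ, 0 ≤ (w (L ξ)).re := by
    refine ae_of_ae_map L.measurable.aemeasurable (p := fun ξ => 0 ≤ (w ξ).re) ?_
    rw [hmap]
    exact Measure.ae_smul_measure hre κ
  have key := map_withDensity_le_smul_iff (aemeasurable_ofReal_re hw) L hκ0 hκ hmap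
  constructor
  · rintro ⟨c, hc, h⟩
    refine ⟨ENNReal.ofReal c⁻¹ * κ, ENNReal.mul_ne_top ENNReal.ofReal_ne_top hκ, ?_⟩
    refine (key _).2 ?_
    filter_upwards [h] with ξ hξ
    rw [mul_assoc (ENNReal.ofReal _), ENNReal.mul_inv_cancel hκ0 hκ, mul_one,
      ← ENNReal.ofReal_mul (by positivity)]
    refine ENNReal.ofReal_le_ofReal ?_
    rw [← div_eq_inv_mul, le_div_iff₀' hc]
    exact hξ
  · rintro ⟨c, hc, h⟩
    have h := (key c).1 h
    have hK : c * κ⁻¹ ≠ ∞ := ENNReal.mul_ne_top hc (ENNReal.inv_ne_top.2 hκ0)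
    set K := c * κ⁻¹
    -- Adding `1` keeps the constant positive and finite even if `K = 0`.
    refine ⟨(K.toReal + 1)⁻¹, by positivity, ?_⟩
    filter_upwards [h, hre, hreL] with ξ hξ h1 h2
    rw [← div_eq_inv_mul, div_le_iff₀' (by positivity)]
    have h3 := ENNReal.toReal_mono (ENNReal.mul_ne_top hK ENNReal.ofReal_ne_top) hξ
    rw [ENNReal.toReal_mul, ENNReal.toReal_ofReal h1, ENNReal.toReal_ofReal h2] at h3
    linarith

theorem integrable_spectralMeasure_iff {F : Type*} [NormedAddCommGroup F] [NormedSpace ℝ F]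
    (hw : AEStronglyMeasurable w) (h0 : ∀ᵐ ξ, 0 ≤ w ξ) (g : EuclideanSpace ℝ (Fin d) → F) :
    Integrable g (spectralMeasure w) ↔ Integrable fun ξ => ‖w ξ‖ • g ξ := by
  rw [spectralMeasure, integrable_withDensity_iff_integrable_smul₀' (aemeasurable_ofReal_re hw)
    (.of_forall fun _ => ENNReal.ofReal_lt_top)]
  refine integrable_congr ?_
  filter_upwards [h0] with ξ hξ
  rw [ENNReal.toReal_ofReal (Complex.le_def.1 hξ).1, Complex.re_eq_norm.2 hξ]

theorem integral_spectralMeasure (hw : AEStronglyMeasurable w) (h0 : ∀ᵐ ξ, 0 ≤ w ξ)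
    (g : EuclideanSpace ℝ (Fin d) → ℂ) :
    ∫ ξ, g ξ ∂spectralMeasure w = ∫ ξ, w ξ * g ξ := by
  rw [spectralMeasure, integral_withDensity_eq_integral_toReal_smul₀ (aemeasurable_ofReal_re hw)
    (.of_forall fun _ => ENNReal.ofReal_lt_top)]
  refine integral_congr_ae ?_
  filter_upwards [h0] with ξ hξ
  rw [ENNReal.toReal_ofReal (Complex.le_def.1 hξ).1, Complex.real_smul]
  congr 1
  exact Complex.ext rfl (Complex.le_def.1 hξ).2

theorem HasSuperexponentialDecay.hasExpMoments (hd : HasSuperexponentialDecay w)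
    (hw : AEStronglyMeasurable w) (h0 : ∀ᵐ ξ, 0 ≤ w ξ) : HasExpMoments (spectralMeasure w) := by
  intro a
  rw [integrable_spectralMeasure_iff hw h0]
  simpa only [smul_eq_mul, mul_comm] using hd.integrable_exp_mul_norm hw a

theorem weightedNorm_eq_eLpNorm (hw : AEStronglyMeasurable w) {h : EuclideanSpace ℝ (Fin d) → ℂ}
    (hh : Continuous h) : weightedNorm w h = eLpNorm h 2 (spectralMeasure w) := by
  rw [eLpNorm_eq_lintegral_rpow_enorm_toReal (by simp) (by simp), spectralMeasure,
    lintegral_withDensity_eq_lintegral_mul₀ (aemeasurable_ofReal_re hw) (by fun_prop),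
    weightedNorm]
  simp [mul_comm]

theorem weightedNorm_expMul_polyFun (hw : AEStronglyMeasurable w)
    (hμ : HasExpMoments (spectralMeasure w)) (z : Fin d → ℂ) (P : MvPolynomial (Fin d) ℂ) :
    weightedNorm w (expMul z (polyFun P)) = ‖expPoly hμ z P‖ₑ := by
  rw [weightedNorm_eq_eLpNorm hw (continuous_expMul z (continuous_polyFun P)), Lp.enorm_def]
  exact (eLpNorm_congr_ae (coeFn_expPoly hμ z P)).symm

theorem HasPolynomialGrowthBound.exists_expGrowthBound (hw : AEStronglyMeasurable w)
    (hμ : HasExpMoments (spectralMeasure w)) (hB : HasPolynomialGrowthBound w) :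
    ∃ C : ℝ, 1 ≤ C ∧ ExpGrowthBound hμ C := by
  set M := ⨆ z : Fin d → ℂ, limsup (fun n : ℕ => expMulPolyNorm w z n ^ (1 / (n : ℝ))) atTop
    with hM
  have hMt : M < ∞ := hB
  -- Adding `1` makes the constant exceed every limsup strictly and be at least `1`. It is uniform
  -- in `z`, while the threshold for `n` may depend on `z`.
  refine ⟨(M.toNNReal + 1 : NNReal), by simp, fun z => ?_⟩
  have hlt : limsup (fun n : ℕ => expMulPolyNorm w z n ^ (1 / (n : ℝ))) atTop <
      ((M.toNNReal + 1 : NNReal) : ℝ≥0∞) := by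
    refine (le_iSup (fun z : Fin d → ℂ =>
      limsup (fun n : ℕ => expMulPolyNorm w z n ^ (1 / (n : ℝ))) atTop) z).trans_lt ?_
    rw [← hM, ENNReal.coe_add, ENNReal.coe_toNNReal hMt.ne]
    exact ENNReal.lt_add_right hMt.ne (by simp)
  filter_upwards [eventually_lt_of_limsup_lt hlt, eventually_gt_atTop 0] with n hn hn0 P hP
  set C : NNReal := M.toNNReal + 1
  have hC0 : C ≠ 0 := by positivity
  by_cases hP0 : P = 0
  · simp [hP0]
  have h1 : expMulPolyNorm w z n ≤ (C : ℝ≥0∞) ^ n := by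
    rw [one_div, ENNReal.rpow_inv_lt_iff (by positivity), ENNReal.rpow_natCast] at hn
    exact hn.le
  have h2 : weightedNorm w (expMul z (polyFun P)) / weightedNorm w (polyFun P) ≤
      (C : ℝ≥0∞) ^ n := by
    refine le_trans ?_ h1
    exact le_iSup_of_le P (le_iSup_of_le hP (le_iSup_of_le hP0 le_rfl))
  rw [ENNReal.div_le_iff_le_mul (.inr (by simp)) (.inr (by simp [hC0])),
    weightedNorm_expMul_polyFun hw hμ, ← expMul_zero (polyFun P),
    weightedNorm_expMul_polyFun hw hμ] at h2
  have h3 := ENNReal.toReal_mono (by finiteness) h2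
  simpa using h3

end SpectralMeasure

theorem spectralMeasure_ne_zero {d : ℕ} {w : EuclideanSpace ℝ (Fin d) → ℂ}
    (hw : AEStronglyMeasurable w) (h0 : ∀ᵐ ξ, 0 ≤ w ξ) (hne : 𝓕⁻ w ≠ 0) :
    spectralMeasure w ≠ 0 := by
  intro h
  rw [spectralMeasure, withDensity_eq_zero_iff (aemeasurable_ofReal_re hw)] at h
  refine hne (funext fun x => ?_)
  rw [Real.fourierInv_eq]
  refine integral_eq_zero_of_ae ?_
  filter_upwards [h, h0] with ξ h1 h2
  have h3 := Complex.le_def.1 h2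
  have h4 : w ξ = 0 := Complex.ext (le_antisymm (by simpa using h1) h3.1) h3.2.symm
  simp [h4]

/-- This makes `x ↦ e_x` a feature map for the kernel; the inner product is conjugate-linear in its
first argument, which accounts for the sign of `x - y`. -/
theorem fourierInv_sub_eq_inner_expPoly {d : ℕ} {w : EuclideanSpace ℝ (Fin d) → ℂ}
    (hw : AEStronglyMeasurable w) (h0 : ∀ᵐ ξ, 0 ≤ w ξ) (hμ : HasExpMoments (spectralMeasure w))
    (x y : EuclideanSpace ℝ (Fin d)) :
    𝓕⁻ w (x - y) = inner ℂ (expPoly hμ (complexify x) 1) (expPoly hμ (complexify y) 1) := by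
  rw [inner_expPoly, integral_spectralMeasure hw h0, Real.fourierInv_eq']
  refine integral_congr_ae (.of_forall fun ξ => ?_)
  simp only [expMul, polyFun_one, mul_one, smul_eq_mul, mul_comm (w ξ)]
  congr 1
  rw [Complex.star_def, ← Complex.exp_conj, ← Complex.exp_add]
  congr 1
  simp only [complexify, map_mul, map_neg, map_sum, Complex.conj_I, Complex.conj_ofReal, inner_sub_right,
    PiLp.inner_apply, map_ofNat]
  push_cast
  simp [mul_comm]
  ring

/-! ### Assembly of the theorem. -/

theorem theorem1 {d : ℕ} (u : EuclideanSpace ℝ (Fin d) → ℂ)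
    (hu_cont : Continuous u) (hu_L2 : MemLp u 2 volume) (hu_ne : u ≠ 0)
    (hu_hat_L1 : MemLp (fourierL2 u hu_L2) 1 volume)
    (hu_hat_Linfty : MemLp (fourierL2 u hu_L2) ∞ volume)
    (hu_hat_nonneg : ∀ᵐ ξ, 0 ≤ fourierL2 u hu_L2 ξ)
    (hA : HasSuperexponentialDecay (fourierL2 u hu_L2))
    (hB : HasPolynomialGrowthBound (fourierL2 u hu_L2))
    (hC : Submodule.span ℝ (admissibleMatrices (fourierL2 u hu_L2)) = ⊤) :
    AnalyticOnNhd ℝ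
      (fun p : EuclideanSpace ℝ (Fin d) × EuclideanSpace ℝ (Fin d) =>
        translationKernel u p.1 p.2) Set.univ ∧
    ∃ hk : (translationKernel u).PosSemidef,
      ∀ (U : Set (EuclideanSpace ℝ (Fin d))), IsOpen U →
        ∀ f : U → EuclideanSpace ℝ (Fin d),
          (∃ A ∈ admissibleMatrices (fourierL2 u hu_L2), ∃ b : EuclideanSpace ℝ (Fin d),
            ∀ x : U, f x = Matrix.toEuclideanLin A (x : EuclideanSpace ℝ (Fin d)) + b) ↔
          ((compositionOperator (KernelSpace (translationKernel u) hk)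
              (KernelSpace (restrictKernel (translationKernel u) U)
                (restrictKernel_posSemidef hk U)) f).domain = ⊤ ∧
            (compositionOperator (KernelSpace (translationKernel u) hk)
              (KernelSpace (restrictKernel (translationKernel u) U)
                (restrictKernel_posSemidef hk U)) f).IsBoundedOnDomain) := by
  have hwm : AEStronglyMeasurable (fourierL2 u hu_L2) := hu_hat_L1.1
  have hinv := eq_fourierInv_fourierL2 hu_cont hu_L2 (memLp_one_iff_integrable.1 hu_hat_L1)
  have hmom : ∀ a : ℝ, Integrable fun ξ => Real.exp (a * ‖ξ‖) * ‖fourierL2 u hu_L2 ξ‖ :=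
    hA.integrable_exp_mul_norm hwm
  have hμ := hA.hasExpMoments hwm hu_hat_nonneg
  -- From here on `u` enters only as the inverse Fourier transform of the weight `w`.
  generalize fourierL2 u hu_L2 = w at *
  have hfin : IsFiniteMeasure (spectralMeasure w) := by
    simpa [integrable_const_iff] using hμ 0
  have hne : spectralMeasure w ≠ 0 :=
    spectralMeasure_ne_zero hwm hu_hat_nonneg (hinv ▸ hu_ne)
  have hac : spectralMeasure w ≪ volume := withDensity_absolutelyContinuous _ _
  obtain ⟨C, hC1, hgrowth⟩ := hB.exists_expGrowthBound hwm hμ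
  rw [admissibleMatrices_eq hwm hu_hat_nonneg] at hC ⊢
  have hΦ : ∀ x y, translationKernel u x y =
      inner ℂ (expPoly hμ (complexify x) 1) (expPoly hμ (complexify y) 1) := fun x y => by
    rw [← fourierInv_sub_eq_inner_expPoly hwm hu_hat_nonneg hμ, ← hinv]
    rfl
  refine ⟨?_, posSemidef_of_inner _ hΦ, fun U hU f => ?_⟩
  · have hsub : (fun p : EuclideanSpace ℝ (Fin d) × EuclideanSpace ℝ (Fin d) =>
        translationKernel u p.1 p.2) = fun p => 𝓕 w (p.2 - p.1) := by
      ext p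
      change u (p.1 - p.2) = _
      rw [hinv, Real.fourierInv_eq_fourier_neg, neg_sub]
    rw [hsub]
    exact (analyticOnNhd_fourier_of_exp_moments hwm hmom).comp
      (analyticOnNhd_snd.sub analyticOnNhd_fst) (Set.mapsTo_univ _ _)
  · rw [compositionOperator_bounded_iff _ _ hΦ U f]
    constructor
    · rintro ⟨A, hA', b, hf⟩
      obtain ⟨T, hT⟩ := exists_clm_of_mem_dominatedMatrices hμ hA' b
      exact ⟨T, fun x => by rw [hT, hf]⟩
    · rintro ⟨T, hT⟩
      exact exists_affine_of_clm hμ hac hne hC1 hgrowth hC hU f hT
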